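/- Let $M$ be a compact smooth $7$-manifold without boundary. A smooth $3$-form $\Omega$ on $M$ is called positive if at every point $x$ there is a linear isomorphism $T_xM\cong\mathbb{R}^7$ under which $\Omega_x$ corresponds to $$\varphi_0=e^{123}+e^{145}+e^{167}+e^{246}-e^{257}-e^{347}-e^{356}.$$ Such a form induces an orientation of $M$, a Riemannian metric $g_\Omega$ and its volume form $\mathrm{vol}_\Omega$, which are determined by $$g_\Omega(u,v)\,\mathrm{vol}_\Omega=\tfrac16\,(u\lrcorner\Omega)\wedge(v\lrcorner\Omega)\wedge\Omega .$$ Let $|\cdot|_\Omega$, $\star_\Omega$ and $\delta_\Omega$ be the norm on forms, the Hodge star operator and the codifferential of this metric and orientation, and let $$\mathcal D(\Omega)=\frac12\int_M\left(|d\Omega|_\Omega^2+|\delta_\Omega\Omega|_\Omega^2\right)\mathrm{vol}_\Omega$$ be the Dirichlet energy. Its negative $L^2$-gradient $Q(\Omega)=-\mathrm{grad}\,\mathcal D(\Omega)$ is the smooth $3$-form determined by $$\frac{d}{ds}\Big|_{s=0}\mathcal D(\Omega+s\psi)=-\int_M Q(\Omega)\wedge\star_\Omega\psi\qquad\text{for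 all smooth 3-forms }\psi .$$ Let $(\Omega_t)_{t\in[0,\infty)}$ be a family of positive $3$-forms on $M$, smooth on $[0,\infty)\times M$, which solves the Dirichlet energy flow $$\frac{\partial}{\partial t}\Omega_t=Q(\Omega_t)\qquad\text{for all }t\in[0,\infty).$$ Then $\lim_{t\to\infty}\mathcal D(\Omega_t)=0$. -/

import Mathlib

open scoped Manifold ContDiff Topology

noncomputable section

namespace G2Flow

/-- The model space `ℝ⁷`, with its standard basis, coordinates and Lebesgue measure. -/
abbrev R7 : Type := EuclideanSpace ℝ (Fin 7)

/-! ### Linear algebra of 3-forms on `ℝ⁷` -/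

/-- The component `α (e_{I 0}, …, e_{I (k-1)})` of a `k`-form on `ℝ⁷` in the standard basis. -/
def comp {k : ℕ} (α : R7 [⋀^Fin k]→L[ℝ] ℝ) (I : Fin k → Fin 7) : ℝ :=
  α fun a => EuclideanSpace.single (I a) (1 : ℝ)

/-- The constant `k`-form `dx^{J 0} ∧ … ∧ dx^{J (k-1)}`, that is
`(v_0, …, v_{k-1}) ↦ det (v_a^{J b})_{a, b}`. -/
def dx {k : ℕ} (J : Fin k → Fin 7) : R7 [⋀^Fin k]→L[ℝ] ℝ :=
  { Matrix.detRowAlternating.compLinearMap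
      (LinearMap.pi fun b : Fin k => (EuclideanSpace.proj (𝕜 := ℝ) (J b) : R7 →L[ℝ] ℝ).toLinearMap)
    with
    cont := by
      change Continuous fun v : Fin k → R7 => Matrix.det (Matrix.of fun a b => (v a) (J b))
      apply Continuous.matrix_det
      fun_prop }

theorem dx_apply {k : ℕ} (J : Fin k → Fin 7) (v : Fin k → R7) :
    dx J v = Matrix.det (Matrix.of fun a b => (v a) (J b)) := rfl

/-- The standard positive 3-form on `ℝ⁷`,
`φ₀ = e¹²³ + e¹⁴⁵ + e¹⁶⁷ + e²⁴⁶ - e²⁵⁷ - e³⁴⁷ - e³⁵⁶` (indices are shifted by one below).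
Its stabiliser in `GL(7)` is `G₂`. -/
def stdForm : R7 [⋀^Fin 3]→L[ℝ] ℝ :=
  dx ![0, 1, 2] + dx ![0, 3, 4] + dx ![0, 5, 6] + dx ![1, 3, 5]
    - dx ![1, 4, 6] - dx ![2, 3, 6] - dx ![2, 4, 5]

/-- The matrix `B` of the `Λ⁷`-valued symmetric bilinear form of a 3-form `φ`:
`(1/6) (e_i ⌟ φ) ∧ (e_j ⌟ φ) ∧ φ = B_{ij} dx^1 ∧ … ∧ dx^7`, where the wedge product of a 2-form,
a 2-form and a 3-form is written out as the sum over permutations divided by `2! 2! 3! = 24`. -/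
def hitchinMatrix (φ : R7 [⋀^Fin 3]→L[ℝ] ℝ) : Matrix (Fin 7) (Fin 7) ℝ :=
  Matrix.of fun i j => (1 / 144 : ℝ) * ∑ σ : Equiv.Perm (Fin 7), ((Equiv.Perm.sign σ : ℤ) : ℝ) *
    (comp φ ![i, σ 0, σ 1] * comp φ ![j, σ 2, σ 3] * comp φ ![σ 4, σ 5, σ 6])

/-- The number `v` with `vol_φ = v dx^1 ∧ … ∧ dx^7`, for the metric and the orientation which a
positive 3-form `φ` induces on `ℝ⁷`. Since `B = v g` and `v ^ 2 = det g`, it is the real ninth root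
of `det B`. It is negative if `φ` induces the opposite of the standard orientation. -/
def volCoeff (φ : R7 [⋀^Fin 3]→L[ℝ] ℝ) : ℝ :=
  Real.sign (hitchinMatrix φ).det * |(hitchinMatrix φ).det| ^ (1 / 9 : ℝ)

/-- The matrix `(g_{ij})` of the inner product induced by a positive 3-form `φ`, determined by
`g(u, w) vol_φ = (1/6) (u ⌟ φ) ∧ (w ⌟ φ) ∧ φ`. -/
def metric (φ : R7 [⋀^Fin 3]→L[ℝ] ℝ) : Matrix (Fin 7) (Fin 7) ℝ :=
  (volCoeff φ)⁻¹ • hitchinMatrix φ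

/-- The product `g^{I 0, J 0} ⋯ g^{I (k-1), J (k-1)}` of entries of the inverse metric. -/
def invMetric {k : ℕ} (φ : R7 [⋀^Fin 3]→L[ℝ] ℝ) (I J : Fin k → Fin 7) : ℝ :=
  ∏ a, (metric φ)⁻¹ (I a) (J a)

/-- The inner product of `k`-forms induced by `φ`,
`⟨α, β⟩_φ = (1/k!) g^{i_1 j_1} ⋯ g^{i_k j_k} α_{i_1 … i_k} β_{j_1 … j_k}`. -/
def formInner {k : ℕ} (φ : R7 [⋀^Fin 3]→L[ℝ] ℝ) (α β : R7 [⋀^Fin k]→L[ℝ] ℝ) : ℝ :=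
  (1 / (k.factorial : ℝ)) * ∑ I : Fin k → Fin 7, ∑ J : Fin k → Fin 7,
    invMetric φ I J * comp α I * comp β J

/-- The Levi-Civita symbol `ε_{I J}` of the concatenation of two multi-indices. -/
def leviCivita {k l : ℕ} (h : k + l = 7) (I : Fin k → Fin 7) (J : Fin l → Fin 7) : ℝ :=
  Matrix.det (Matrix.of fun a b : Fin 7 =>
    if Fin.append I J (Fin.cast h.symm a) = b then (1 : ℝ) else 0)

/-- The Hodge star operator of the metric and orientation induced by `φ`, on `k`-forms:
`(⋆α)_{j_1 … j_l} = (1/k!) v g^{i_1 i'_1} ⋯ g^{i_k i'_k} α_{i'_1 … i'_k} ε_{i_1 … i_k j_1 … j_l}`,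
so that `α ∧ ⋆β = ⟨α, β⟩_φ vol_φ`. -/
def hodgeStar {k l : ℕ} (h : k + l = 7) (φ : R7 [⋀^Fin 3]→L[ℝ] ℝ) (α : R7 [⋀^Fin k]→L[ℝ] ℝ) :
    R7 [⋀^Fin l]→L[ℝ] ℝ :=
  (1 / (l.factorial : ℝ)) • ∑ J : Fin l → Fin 7,
    ((1 / (k.factorial : ℝ)) * volCoeff φ *
      ∑ I : Fin k → Fin 7, ∑ I' : Fin k → Fin 7,
        invMetric φ I I' * comp α I' * leviCivita h I J) • dx J

/-! ### The energy density in coordinates -/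

/-- The codifferential `δ_φ φ = -⋆_φ d ⋆_φ φ` of a 3-form on (an open subset of) `ℝ⁷` with respect
to the metric it induces. -/
def codiff (φ : R7 → R7 [⋀^Fin 3]→L[ℝ] ℝ) (y : R7) : R7 [⋀^Fin 2]→L[ℝ] ℝ :=
  -hodgeStar (k := 5) (l := 2) rfl (φ y)
    (extDeriv (fun z => hodgeStar (k := 3) (l := 4) rfl (φ z) (φ z)) y)

/-- The Dirichlet energy density `½ (|dφ|² + |δ_φ φ|²) vol_φ` with respect to Lebesgue measure. -/
def energyDensity (φ : R7 → R7 [⋀^Fin 3]→L[ℝ] ℝ) (y : R7) : ℝ :=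
  (1 / 2 : ℝ) * (formInner (φ y) (extDeriv φ y) (extDeriv φ y)
    + formInner (φ y) (codiff φ y) (codiff φ y)) * |volCoeff (φ y)|

/-! ### 3-forms on a 7-manifold -/

variable (M : Type*) [TopologicalSpace M] [ChartedSpace R7 M]

/-- Not necessarily continuous 3-forms on `M`. -/
abbrev ThreeForm : Type _ := (x : M) → (TangentSpace (𝓡 7) x) [⋀^Fin 3]→L[ℝ] ℝ

variable {M}

/-- The coordinate expression of a 3-form in the chart around `c`: its pullback under the inverse of the chart.
It is meaningful on the target of the chart. -/
def inChart (φ : ThreeForm M) (c : M) (y : R7) : R7 [⋀^Fin 3]→L[ℝ] ℝ :=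
  (φ ((chartAt R7 c).symm y)).compContinuousLinearMap
    (mfderiv (𝓡 7) (𝓡 7) (chartAt R7 c).symm y)

/-- Smooth 3-forms, `Ω³(M)`. -/
def IsSmooth (φ : ThreeForm M) : Prop :=
  ∀ c : M, ContDiffOn ℝ ∞ (inChart φ c) (chartAt R7 c).target

/-- Positivity: at each point `x` there is a linear isomorphism `T_x M ≃ ℝ⁷` under which `φ`
corresponds to the standard form. -/
def IsPositive (φ : ThreeForm M) : Prop :=
  ∀ x : M, ∃ A : TangentSpace (𝓡 7) x ≃L[ℝ] R7,
    φ x = stdForm.compContinuousLinearMap (A : TangentSpace (𝓡 7) x →L[ℝ] R7)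

variable (M) in
/-- A smooth partition of unity on `M` subordinate to the cover by the domains of the charts. -/
def chartPartition [IsManifold (𝓡 7) ∞ M] [T2Space M] [CompactSpace M] :
    SmoothPartitionOfUnity M (𝓡 7) M Set.univ :=
  (SmoothPartitionOfUnity.exists_isSubordinate_chartAt_source (𝓡 7) M).choose

theorem chartPartition_isSubordinate [IsManifold (𝓡 7) ∞ M] [T2Space M] [CompactSpace M] :
    (chartPartition M).IsSubordinate fun x => (chartAt R7 x).source :=
  (SmoothPartitionOfUnity.exists_isSubordinate_chartAt_source (𝓡 7) M).choose_spec

variable [IsManifold (𝓡 7) ∞ M] [T2Space M] [CompactSpace M]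

/-- The integral over `M` of a density, given by its coordinate expression `f c` (a function on the
target of the chart around `c`, to be integrated against Lebesgue measure) for every `c`. -/
def integral (f : M → R7 → ℝ) : ℝ :=
  ∑ᶠ c : M, ∫ y in (chartAt R7 c).target, chartPartition M c ((chartAt R7 c).symm y) * f c y

/-- The Dirichlet energy `𝒟(Ω) = ½ ∫_M (|dΩ|² + |δ_Ω Ω|²) vol_Ω`. -/
def dirichletEnergy (Ω : ThreeForm M) : ℝ :=
  integral fun c y => energyDensity (inChart Ω c) y

/-- The `L²` inner product `⟨α, β⟩_Ω = ∫_M α ∧ ⋆_Ω β = ∫_M ⟨α, β⟩_Ω vol_Ω` of 3-forms. -/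
def l2Inner (Ω α β : ThreeForm M) : ℝ :=
  integral fun c y =>
    formInner (inChart Ω c y) (inChart α c y) (inChart β c y) * |volCoeff (inChart Ω c y)|

/-- `Q` is the negative `L²`-gradient of the Dirichlet energy at `Ω`: it is the smooth 3-form with
`D_Ω 𝒟(ψ) = -⟨Q, ψ⟩_Ω` for all smooth 3-forms `ψ`. -/
def IsNegGradient (Ω Q : ThreeForm M) : Prop :=
  IsSmooth Q ∧ ∀ ψ : ThreeForm M, IsSmooth ψ →
    HasDerivAt (fun s : ℝ => dirichletEnergy (Ω + s • ψ)) (-l2Inner Ω Q ψ) 0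

/-- `(Ω_t)`, `t ∈ [0, ∞)`, is a solution of the Dirichlet energy flow `∂_t Ω_t = -grad 𝒟(Ω_t)`:
a family of positive 3-forms, smooth on `[0, ∞) × M`, satisfying the flow equation. The values at
negative times are irrelevant. -/
structure IsDirichletFlow (Ω : ℝ → ThreeForm M) : Prop where
  positive : ∀ t, 0 ≤ t → IsPositive (Ω t)
  smooth : ∀ c : M, ContDiffOn ℝ ∞ (fun p : ℝ × R7 => inChart (Ω p.1) c p.2)
    (Set.Ici (0 : ℝ) ×ˢ (chartAt R7 c).target)
  flow : ∀ t, 0 ≤ t → ∃ Q : ThreeForm M, IsNegGradient (Ω t) Q ∧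
    ∀ (x : M) (v : Fin 3 → TangentSpace (𝓡 7) x),
      HasDerivWithinAt (fun s => Ω s x v) (Q x v) (Set.Ici 0) t

end G2Flow

end

/-! The proof plays the energy against the volume of the evolving metric. Multiplying `Ω` by `a ^ 3`
multiplies the metric by `a ^ 2`, the volume form by `a ^ 7` and `𝒟` by `a ^ 5`. So `𝒟` is
homogeneous of degree `5/3`, and Euler's identity (`energyVariation_self`) gives `-⟨Q, Ω⟩ = 5/3
𝒟(Ω)`. The derivative of the volume in a direction `ψ` is `κ ⟨Ω, ψ⟩` with a constant `κ > 0`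
(`exists_volumeVariation_eq`). Along the flow, therefore, `d/dt Vol = κ ⟨Ω, Q⟩ = -(5/3) κ 𝒟`. The
volume stays nonnegative, while `d/dt 𝒟 = -‖Q‖² ≤ 0`; a nonincreasing `𝒟` bounded away from zero
would make the volume negative in finite time (`tendsto_zero_of_antitone_of_deriv`).

The pointwise input is `exists_fderiv_absVol`. Everything is equivariant under `GL(7)`, so it is
enough to work at the standard form. There a finite group of signed permutations already forces the
metric to be a multiple of the identity and every invariant functional on 3-forms to be a multiple
of the inner product with the standard form. The sign of `κ` comes from Euler's identity for the
volume, of degree `7/3`; no normalising constant is ever computed.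

The analytic input is that the energy density is a smooth function of the 1-jet of the form, so that
the energy may be differentiated under the integral sign along any smooth family. Its derivative
depends only on the form and its velocity, which links the gradient, defined by straight lines, to
the flow. -/

noncomputable section

namespace G2Flow

/-! ### Forms and bases -/

/-- The standard basis vector. -/
abbrev stdVec (i : Fin 7) : R7 := EuclideanSpace.single i (1 : ℝ)

theorem sum_smul_stdVec (v : R7) : ∑ i, v i • stdVec i = v := by
  ext j
  simp [stdVec, Finset.sum_apply, Pi.single_apply]

theorem sum_prod_mul_comp {k : ℕ} (α : R7 [⋀^Fin k]→L[ℝ] ℝ) (v : Fin k → R7) :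
    ∑ I : Fin k → Fin 7, (∏ a, v a (I a)) * comp α I = α v := by
  have h := α.toMultilinearMap.map_sum (fun a (i : Fin 7) => v a i • stdVec i)
  have h2 : (fun a => ∑ i, v a i • stdVec i) = v := by
    funext a; exact sum_smul_stdVec (v a)
  rw [h2] at h
  change α v = _ at h
  rw [h]
  refine Finset.sum_congr rfl fun I _ => ?_
  have := α.toMultilinearMap.map_smul_univ (fun a => v a (I a)) (fun a => stdVec (I a))
  rw [this]
  rfl

theorem comp_ext {k : ℕ} {α β : R7 [⋀^Fin k]→L[ℝ] ℝ} (h : ∀ I, comp α I = comp β I) : α = β := by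
  ext v
  rw [← sum_prod_mul_comp α v, ← sum_prod_mul_comp β v]
  simp [h]

@[simp] theorem comp_add {k : ℕ} (α β : R7 [⋀^Fin k]→L[ℝ] ℝ) (I : Fin k → Fin 7) :
    comp (α + β) I = comp α I + comp β I := rfl

@[simp] theorem comp_sub {k : ℕ} (α β : R7 [⋀^Fin k]→L[ℝ] ℝ) (I : Fin k → Fin 7) :
    comp (α - β) I = comp α I - comp β I := rfl

@[simp] theorem comp_smul {k : ℕ} (c : ℝ) (α : R7 [⋀^Fin k]→L[ℝ] ℝ) (I : Fin k → Fin 7) :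
    comp (c • α) I = c * comp α I := rfl

theorem comp_sum {ι : Type*} (s : Finset ι) {k : ℕ} (α : ι → R7 [⋀^Fin k]→L[ℝ] ℝ)
    (I : Fin k → Fin 7) : comp (∑ i ∈ s, α i) I = ∑ i ∈ s, comp (α i) I := by
  simp [comp]

/-- Evaluation of components as a continuous linear map. -/
def compL {k : ℕ} (I : Fin k → Fin 7) : (R7 [⋀^Fin k]→L[ℝ] ℝ) →L[ℝ] ℝ :=
  ContinuousAlternatingMap.apply ℝ R7 ℝ fun a => stdVec (I a)

@[simp] theorem compL_apply {k : ℕ} (I : Fin k → Fin 7) (α : R7 [⋀^Fin k]→L[ℝ] ℝ) :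
    compL I α = comp α I := rfl

theorem comp_dx {k : ℕ} (J I : Fin k → Fin 7) :
    comp (dx J) I = Matrix.det (Matrix.of fun a b => if I a = J b then (1 : ℝ) else 0) := by
  rw [comp, dx_apply]
  congr 1
  ext a b
  simp [eq_comm]

theorem comp_comp_perm {k : ℕ} (α : R7 [⋀^Fin k]→L[ℝ] ℝ) (I : Fin k → Fin 7)
    (σ : Equiv.Perm (Fin k)) : comp α (I ∘ σ) = ((Equiv.Perm.sign σ : ℤ) : ℝ) * comp α I := by
  have := α.toAlternatingMap.map_perm (fun a => stdVec (I a)) σ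
  rw [Units.smul_def, zsmul_eq_mul] at this
  exact this

/-- Each of the `k!` terms of the determinant picks out one multi-index `J`, a permutation of `I`;
its sign cancels against that of `comp α J`. -/
theorem sum_comp_smul_dx {k : ℕ} (α : R7 [⋀^Fin k]→L[ℝ] ℝ) :
    (1 / (k.factorial : ℝ)) • ∑ J : Fin k → Fin 7, comp α J • dx J = α := by
  refine comp_ext fun I => ?_
  rw [comp_smul, comp_sum]
  simp only [comp_smul, comp_dx, Matrix.det_apply', Matrix.of_apply]
  have h : ∀ σ : Equiv.Perm (Fin k), ∑ J : Fin k → Fin 7,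
      comp α J * (((Equiv.Perm.sign σ : ℤ) : ℝ) * ∏ i, if I (σ i) = J i then (1 : ℝ) else 0)
      = comp α I := by
    intro σ
    rw [Finset.sum_eq_single (I ∘ σ)]
    · rw [comp_comp_perm]
      have : ((Equiv.Perm.sign σ : ℤ) : ℝ) * ((Equiv.Perm.sign σ : ℤ) : ℝ) = 1 := by
        rcases Int.units_eq_one_or (Equiv.Perm.sign σ) with h | h <;> simp [h]
      simp only [Function.comp_apply, if_true, Finset.prod_const_one, mul_one]
      linear_combination comp α I * this
    · intro J _ hJ
      obtain ⟨i, hi⟩ := Function.ne_iff.1 hJ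
      rw [Finset.prod_eq_zero (Finset.mem_univ i)]
      · simp
      · rw [if_neg]
        exact fun h => hi h.symm
    · simp
  simp_rw [Finset.mul_sum]
  rw [Finset.sum_comm]
  simp_rw [← Finset.mul_sum]
  simp_rw [h]
  simp only [Finset.sum_const, Finset.card_univ, Fintype.card_perm, Fintype.card_fin, nsmul_eq_mul]
  have : (k.factorial : ℝ) ≠ 0 := by positivity
  field_simp

/-- Pullback of forms on `ℝ⁷`. -/
abbrev pull {k : ℕ} (α : R7 [⋀^Fin k]→L[ℝ] ℝ) (A : R7 →L[ℝ] R7) : R7 [⋀^Fin k]→L[ℝ] ℝ :=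
  α.compContinuousLinearMap A

theorem pull_apply {k : ℕ} (α : R7 [⋀^Fin k]→L[ℝ] ℝ) (A : R7 →L[ℝ] R7) (v : Fin k → R7) :
    pull α A v = α fun a => A (v a) := rfl

/-- The matrix of an endomorphism of `ℝ⁷` in the standard basis. -/
def mat (A : R7 →L[ℝ] R7) : Matrix (Fin 7) (Fin 7) ℝ := Matrix.of fun i j => A (stdVec j) i

theorem mat_eq_toMatrix (A : R7 →L[ℝ] R7) :
    mat A = LinearMap.toMatrix (EuclideanSpace.basisFun (Fin 7) ℝ).toBasis
      (EuclideanSpace.basisFun (Fin 7) ℝ).toBasis A.toLinearMap := by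
  ext i j
  simp [mat, LinearMap.toMatrix_apply]

theorem mat_mul (A B : R7 →L[ℝ] R7) : mat (A.comp B) = mat A * mat B := by
  simp only [mat_eq_toMatrix]
  exact LinearMap.toMatrix_comp _ _ _ _ _

theorem mat_id : mat (ContinuousLinearMap.id ℝ R7) = 1 := by
  rw [mat_eq_toMatrix]
  exact LinearMap.toMatrix_id _

/-! ### The Hitchin form -/

theorem update_three_zero (x y z u : R7) : Function.update ![x, y, z] 0 u = ![u, y, z] := by
  funext a; fin_cases a <;> rfl

theorem update_three_one (x y z u : R7) : Function.update ![x, y, z] 1 u = ![x, u, z] := by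
  funext a; fin_cases a <;> rfl

theorem update_three_two (x y z u : R7) : Function.update ![x, y, z] 2 u = ![x, y, u] := by
  funext a; fin_cases a <;> rfl

theorem map_three_zero (φ : R7 [⋀^Fin 3]→L[ℝ] ℝ) (x y z w : R7) :
    φ ![x + y, z, w] = φ ![x, z, w] + φ ![y, z, w] := by
  have := φ.map_update_add ![x, z, w] 0 x y
  rwa [update_three_zero, update_three_zero, update_three_zero] at this

theorem map_three_one (φ : R7 [⋀^Fin 3]→L[ℝ] ℝ) (x y z w : R7) :
    φ ![z, x + y, w] = φ ![z, x, w] + φ ![z, y, w] := by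
  have := φ.map_update_add ![z, x, w] 1 x y
  rwa [update_three_one, update_three_one, update_three_one] at this

theorem map_three_two (φ : R7 [⋀^Fin 3]→L[ℝ] ℝ) (x y z w : R7) :
    φ ![z, w, x + y] = φ ![z, w, x] + φ ![z, w, y] := by
  have := φ.map_update_add ![z, w, x] 2 x y
  rwa [update_three_two, update_three_two, update_three_two] at this

theorem map_three_smul_zero (φ : R7 [⋀^Fin 3]→L[ℝ] ℝ) (c : ℝ) (x z w : R7) :
    φ ![c • x, z, w] = c * φ ![x, z, w] := by
  have := φ.map_update_smul ![x, z, w] 0 c x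
  rwa [update_three_zero, update_three_zero] at this

theorem map_three_smul_one (φ : R7 [⋀^Fin 3]→L[ℝ] ℝ) (c : ℝ) (x z w : R7) :
    φ ![z, c • x, w] = c * φ ![z, x, w] := by
  have := φ.map_update_smul ![z, x, w] 1 c x
  rwa [update_three_one, update_three_one] at this

theorem map_three_smul_two (φ : R7 [⋀^Fin 3]→L[ℝ] ℝ) (c : ℝ) (x z w : R7) :
    φ ![z, w, c • x] = c * φ ![z, w, x] := by
  have := φ.map_update_smul ![z, w, x] 2 c x
  rwa [update_three_two, update_three_two] at this

/-- The multilinear map `(x ⌟ φ) ⊗ (y ⌟ φ) ⊗ φ`. -/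
def hitchinTensor (φ : R7 [⋀^Fin 3]→L[ℝ] ℝ) (x y : R7) :
    MultilinearMap ℝ (fun _ : Fin 7 => R7) ℝ :=
  MultilinearMap.mk' (fun v => φ ![x, v 0, v 1] * φ ![y, v 2, v 3] * φ ![v 4, v 5, v 6])
    (by
      intro m i u w
      fin_cases i <;>
        simp [Function.update, map_three_zero, map_three_one, map_three_two] <;> ring)
    (by
      intro m i c u
      fin_cases i <;>
        simp [Function.update, map_three_smul_zero, map_three_smul_one, map_three_smul_two] <;>
        ring)

/-- The 7-form `24 (x ⌟ φ) ∧ (y ⌟ φ) ∧ φ`. -/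
def hitchinForm (φ : R7 [⋀^Fin 3]→L[ℝ] ℝ) (x y : R7) : R7 [⋀^Fin 7]→ₗ[ℝ] ℝ :=
  MultilinearMap.alternatization (hitchinTensor φ x y)

theorem hitchinForm_apply (φ : R7 [⋀^Fin 3]→L[ℝ] ℝ) (x y : R7) (v : Fin 7 → R7) :
    hitchinForm φ x y v = ∑ σ : Equiv.Perm (Fin 7), ((Equiv.Perm.sign σ : ℤ) : ℝ) *
      (φ ![x, v (σ 0), v (σ 1)] * φ ![y, v (σ 2), v (σ 3)] * φ ![v (σ 4), v (σ 5), v (σ 6)]) := by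
  rw [hitchinForm, MultilinearMap.alternatization_apply]
  refine Finset.sum_congr rfl fun σ _ => ?_
  rw [Units.smul_def, zsmul_eq_mul]
  rfl

-- Keeps the sum over 5040 permutations from being unfolded.
attribute [irreducible] hitchinForm

theorem comp_three (φ : R7 [⋀^Fin 3]→L[ℝ] ℝ) (i j k : Fin 7) :
    comp φ ![i, j, k] = φ ![stdVec i, stdVec j, stdVec k] := by
  rw [comp]
  congr 1
  funext a
  fin_cases a <;> rfl

theorem hitchinMatrix_apply (φ : R7 [⋀^Fin 3]→L[ℝ] ℝ) (i j : Fin 7) :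
    hitchinMatrix φ i j = 1 / 144 * hitchinForm φ (stdVec i) (stdVec j) stdVec := by
  rw [hitchinForm_apply]
  simp only [hitchinMatrix, Matrix.of_apply, comp_three]

theorem hitchinForm_add_left (φ : R7 [⋀^Fin 3]→L[ℝ] ℝ) (x x' y : R7) (v : Fin 7 → R7) :
    hitchinForm φ (x + x') y v = hitchinForm φ x y v + hitchinForm φ x' y v := by
  simp only [hitchinForm_apply, map_three_zero, ← Finset.sum_add_distrib]
  exact Finset.sum_congr rfl fun σ _ => by ring

theorem hitchinForm_smul_left (φ : R7 [⋀^Fin 3]→L[ℝ] ℝ) (c : ℝ) (x y : R7) (v : Fin 7 → R7) :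
    hitchinForm φ (c • x) y v = c * hitchinForm φ x y v := by
  simp only [hitchinForm_apply, map_three_smul_zero, Finset.mul_sum]
  exact Finset.sum_congr rfl fun σ _ => by ring

theorem hitchinForm_add_right (φ : R7 [⋀^Fin 3]→L[ℝ] ℝ) (x y y' : R7) (v : Fin 7 → R7) :
    hitchinForm φ x (y + y') v = hitchinForm φ x y v + hitchinForm φ x y' v := by
  simp only [hitchinForm_apply, map_three_zero, ← Finset.sum_add_distrib]
  exact Finset.sum_congr rfl fun σ _ => by ring

theorem hitchinForm_smul_right (φ : R7 [⋀^Fin 3]→L[ℝ] ℝ) (c : ℝ) (x y : R7) (v : Fin 7 → R7) :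
    hitchinForm φ x (c • y) v = c * hitchinForm φ x y v := by
  simp only [hitchinForm_apply, map_three_smul_zero, Finset.mul_sum]
  exact Finset.sum_congr rfl fun σ _ => by ring

theorem bilinear_eq_sum {F : R7 → R7 → ℝ} (hl : ∀ x x' y, F (x + x') y = F x y + F x' y)
    (hl' : ∀ (c : ℝ) x y, F (c • x) y = c * F x y) (hr : ∀ x y y', F x (y + y') = F x y + F x y')
    (hr' : ∀ (c : ℝ) x y, F x (c • y) = c * F x y) (x y : R7) :
    F x y = ∑ k, ∑ l, x k * y l * F (stdVec k) (stdVec l) := by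
  change LinearMap.mk₂ ℝ F hl hl' hr hr' x y = _
  conv_lhs => rw [← sum_smul_stdVec x, ← sum_smul_stdVec y]
  simp only [map_sum, LinearMap.sum_apply, map_smul, LinearMap.smul_apply, smul_eq_mul,
    Finset.mul_sum]
  rw [Finset.sum_comm]
  refine Finset.sum_congr rfl fun k _ => Finset.sum_congr rfl fun l _ => ?_
  rw [LinearMap.mk₂_apply]
  ring

theorem hitchinForm_stdVec_eq_sum (φ : R7 [⋀^Fin 3]→L[ℝ] ℝ) (x y : R7) (v : Fin 7 → R7) :
    hitchinForm φ x y v = ∑ k, ∑ l, x k * y l * hitchinForm φ (stdVec k) (stdVec l) v :=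
  bilinear_eq_sum (F := fun x y => hitchinForm φ x y v)
    (fun x x' y => hitchinForm_add_left φ x x' y v) (fun c x y => hitchinForm_smul_left φ c x y v)
    (fun x y y' => hitchinForm_add_right φ x y y' v)
    (fun c x y => hitchinForm_smul_right φ c x y v) x y

theorem hitchinForm_pull (φ : R7 [⋀^Fin 3]→L[ℝ] ℝ) (A : R7 →L[ℝ] R7) (x y : R7)
    (v : Fin 7 → R7) :
    hitchinForm (pull φ A) x y v = hitchinForm φ (A x) (A y) (fun i => A (v i)) := by
  have h : ∀ a b c : R7, (fun i => A (![a, b, c] i)) = ![A a, A b, A c] := by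
    intro a b c; funext i; fin_cases i <;> rfl
  simp only [hitchinForm_apply, pull_apply, h]

theorem alternating_apply_eq_det (η : R7 [⋀^Fin 7]→ₗ[ℝ] ℝ) (A : R7 →L[ℝ] R7) :
    η (fun i => A (stdVec i)) = (mat A).det * η stdVec := by
  have h := η.eq_smul_basis_det (EuclideanSpace.basisFun (Fin 7) ℝ).toBasis
  have h1 := congrArg (fun ξ : R7 [⋀^Fin 7]→ₗ[ℝ] ℝ => ξ (fun i => A (stdVec i))) h
  have hb : (⇑(EuclideanSpace.basisFun (Fin 7) ℝ).toBasis : Fin 7 → R7) = stdVec := by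
    funext i; simp
  have h2 : (EuclideanSpace.basisFun (Fin 7) ℝ).toBasis.det (fun i => A (stdVec i))
      = (mat A).det := by
    rw [Module.Basis.det_apply]
    refine congrArg Matrix.det ?_
    ext i j
    simp [mat, Module.Basis.toMatrix_apply]
  simp only [AlternatingMap.smul_apply, hb] at h1
  rw [h1, h2, smul_eq_mul, mul_comm]

/-- The seven alternating slots contribute the determinant, the two bilinear slots the congruence by
`mat A`. -/
theorem hitchinMatrix_pull (φ : R7 [⋀^Fin 3]→L[ℝ] ℝ) (A : R7 →L[ℝ] R7) :
    hitchinMatrix (pull φ A) = (mat A).det • ((mat A).transpose * hitchinMatrix φ * mat A) := by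
  ext i j
  rw [hitchinMatrix_apply, hitchinForm_pull, alternating_apply_eq_det, hitchinForm_stdVec_eq_sum]
  simp only [Matrix.smul_apply, Matrix.mul_apply, Matrix.transpose_apply, smul_eq_mul,
    Finset.sum_mul, hitchinMatrix_apply]
  rw [Finset.sum_comm]
  simp only [Finset.mul_sum]
  refine Finset.sum_congr rfl fun k _ => Finset.sum_congr rfl fun l _ => ?_
  simp only [mat, Matrix.of_apply]
  ring

/-- The exponent is `7 + 2`: a scalar factor on a `7 × 7` matrix and a congruence. This is what
makes the ninth root in `volCoeff` transform as a density. -/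
theorem det_hitchinMatrix_pull (φ : R7 [⋀^Fin 3]→L[ℝ] ℝ) (A : R7 →L[ℝ] R7) :
    (hitchinMatrix (pull φ A)).det = (mat A).det ^ 9 * (hitchinMatrix φ).det := by
  rw [hitchinMatrix_pull, Matrix.det_smul, Matrix.det_mul, Matrix.det_mul, Matrix.det_transpose,
    Fintype.card_fin]
  ring

/-! ### The standard form and its symmetries -/

/-- The components of `dx^a ∧ dx^b ∧ dx^c`. -/
def dxCoeff (a b c i j k : Fin 7) : ℤ :=
  let e : Fin 7 → Fin 7 → ℤ := fun p q => if p = q then 1 else 0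
  e i a * e j b * e k c - e i a * e j c * e k b - e i b * e j a * e k c + e i b * e j c * e k a
    + e i c * e j a * e k b - e i c * e j b * e k a

/-- The components of the standard form. -/
def stdCoeff (i j k : Fin 7) : ℤ :=
  dxCoeff 0 1 2 i j k + dxCoeff 0 3 4 i j k + dxCoeff 0 5 6 i j k + dxCoeff 1 3 5 i j k
    - dxCoeff 1 4 6 i j k - dxCoeff 2 3 6 i j k - dxCoeff 2 4 5 i j k

/-- Integer coefficients turn the finite checks below into decidable statements. -/
theorem comp_dx_three (a b c i j k : Fin 7) :
    comp (dx ![a, b, c]) ![i, j, k] = (dxCoeff a b c i j k : ℝ) := by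
  rw [comp_dx, Matrix.det_fin_three]
  have h : ∀ p q : Fin 7, (((if p = q then 1 else 0 : ℤ)) : ℝ) = if p = q then (1 : ℝ) else 0 := by
    intro p q; split_ifs <;> simp
  simp only [dxCoeff, Int.cast_add, Int.cast_sub, Int.cast_mul, h]
  rfl

theorem comp_stdForm (i j k : Fin 7) : comp stdForm ![i, j, k] = (stdCoeff i j k : ℝ) := by
  simp only [stdForm, comp_add, comp_sub, comp_dx_three, stdCoeff]
  push_cast
  ring

/-- The endomorphism `e_{ρ i} ↦ s_i e_i` of `ℝ⁷`. -/
def monomialMap (s : Fin 7 → ℤ) (ρ : Equiv.Perm (Fin 7)) : R7 →L[ℝ] R7 :=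
  LinearMap.toContinuousLinearMap
    { toFun := fun v => WithLp.toLp 2 fun j => (s j : ℝ) * v (ρ j)
      map_add' := fun v w => by ext j; simp [mul_add]
      map_smul' := fun c v => by ext j; simp; ring }

theorem monomialMap_apply (s : Fin 7 → ℤ) (ρ : Equiv.Perm (Fin 7)) (v : R7) (j : Fin 7) :
    monomialMap s ρ v j = (s j : ℝ) * v (ρ j) := rfl

theorem monomialMap_stdVec (s : Fin 7 → ℤ) (ρ : Equiv.Perm (Fin 7)) (i : Fin 7) :
    monomialMap s ρ (stdVec (ρ i)) = (s i : ℝ) • stdVec i := by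
  ext j
  rw [monomialMap_apply]
  by_cases h : j = i
  · subst h; simp
  · have : ρ j ≠ ρ i := fun h' => h (ρ.injective h')
    simp [h, this]

theorem comp_pull_monomialMap {k : ℕ} (α : R7 [⋀^Fin k]→L[ℝ] ℝ) (s : Fin 7 → ℤ)
    (ρ : Equiv.Perm (Fin 7)) (I : Fin k → Fin 7) :
    comp (pull α (monomialMap s ρ)) (fun a => ρ (I a)) = (∏ a, (s (I a) : ℝ)) * comp α I := by
  rw [comp, pull_apply]
  simp only [monomialMap_stdVec]
  exact α.toMultilinearMap.map_smul_univ (fun a => (s (I a) : ℝ)) (fun a => stdVec (I a))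

theorem pull_dx_monomialMap {k : ℕ} (s : Fin 7 → ℤ) (ρ : Equiv.Perm (Fin 7))
    (J : Fin k → Fin 7) :
    pull (dx J) (monomialMap s ρ) = (∏ a, (s (J a) : ℝ)) • dx fun a => ρ (J a) := by
  ext v
  rw [pull_apply, dx_apply, ContinuousAlternatingMap.smul_apply, dx_apply, smul_eq_mul,
    ← Matrix.det_mul_row]
  rfl

/-- A signed permutation of the coordinates preserves the standard form. -/
def IsSymmetry (s : Fin 7 → ℤ) (ρ : Equiv.Perm (Fin 7)) : Prop :=
  ∀ i j k, stdCoeff (ρ i) (ρ j) (ρ k) = s i * s j * s k * stdCoeff i j k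

instance (s : Fin 7 → ℤ) (ρ : Equiv.Perm (Fin 7)) : Decidable (IsSymmetry s ρ) := by
  unfold IsSymmetry; infer_instance

theorem fin_three_eta (I : Fin 3 → Fin 7) : I = ![I 0, I 1, I 2] := by
  funext a; fin_cases a <;> rfl

theorem IsSymmetry.pull_stdForm {s : Fin 7 → ℤ} {ρ : Equiv.Perm (Fin 7)} (h : IsSymmetry s ρ) :
    pull stdForm (monomialMap s ρ) = stdForm := by
  refine comp_ext fun I => ?_
  obtain ⟨K, rfl⟩ : ∃ K : Fin 3 → Fin 7, I = fun a => ρ (K a) :=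
    ⟨fun a => ρ.symm (I a), by funext a; simp⟩
  rw [comp_pull_monomialMap]
  have e1 : (fun a => ρ (K a)) = ![ρ (K 0), ρ (K 1), ρ (K 2)] := by
    funext a; fin_cases a <;> rfl
  rw [e1, comp_stdForm, h, Fin.prod_univ_three, fin_three_eta K, comp_stdForm]
  push_cast
  rfl

/-- The determinant is kept as an unknown; it is recovered later by comparing nonzero entries. -/
theorem IsSymmetry.hitchinMatrix_stdForm {s : Fin 7 → ℤ} {ρ : Equiv.Perm (Fin 7)}
    (h : IsSymmetry s ρ) (i j : Fin 7) :
    hitchinMatrix stdForm (ρ i) (ρ j) =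
      (mat (monomialMap s ρ)).det * (s i * s j * hitchinMatrix stdForm i j) := by
  rw [hitchinMatrix_apply, hitchinMatrix_apply]
  conv_lhs => rw [← h.pull_stdForm]
  rw [hitchinForm_pull, alternating_apply_eq_det, monomialMap_stdVec, monomialMap_stdVec,
    hitchinForm_smul_left, hitchinForm_smul_right]
  ring

/-! ### The Hitchin matrix of the standard form is a positive scalar -/

/-- The character of `(ℤ/2)³` with index `m`, on the nonzero elements `1, …, 7`. -/
def signChar (m : Fin 3) (i : Fin 7) : ℤ := if (i.val + 1).testBit m then -1 else 1

/-- A symmetry of order seven of the standard form. -/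
def cyclePerm : Equiv.Perm (Fin 7) where
  toFun := ![1, 3, 5, 2, 0, 6, 4]
  invFun := ![4, 0, 3, 1, 6, 2, 5]
  left_inv := by decide
  right_inv := by decide

/-- With labels `1, …, 7`, the seven triples of the standard form are the lines of the Fano plane:
the three labels add up to zero in `(ℤ/2)³`, so a character has product one on each. -/
theorem isSymmetry_signChar (m : Fin 3) : IsSymmetry (signChar m) 1 := by
  revert m; decide +kernel

theorem isSymmetry_cyclePerm : IsSymmetry (fun _ => 1) cyclePerm := by
  decide +kernel

-- The permutation is enumerated as nested choices, and a branch is dropped at the first vanishing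
-- coefficient, which keeps the search small. Nonvanishing also excludes repetitions inside a
-- triple. The product over `i < j` is the sign counted by inversions.
set_option synthInstance.maxSize 2000 in
theorem stdCoeff_mul_nonneg : ∀ a b, stdCoeff 0 a b ≠ 0 → ∀ c, c ∉ [a, b] →
    ∀ d, d ∉ [a, b] ∧ stdCoeff 0 c d ≠ 0 → ∀ e, e ∉ [a, b, c, d] →
    ∀ f, f ∉ [a, b, c, d] → ∀ g, g ∉ [a, b, c, d] ∧ stdCoeff e f g ≠ 0 →
    0 ≤ (∏ j, ∏ i ∈ Finset.Iio j,
        if (![a, b, c, d, e, f, g] : Fin 7 → Fin 7) i < (![a, b, c, d, e, f, g] : Fin 7 → Fin 7) j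
          then (1 : ℤ) else -1) *
      (stdCoeff 0 a b * stdCoeff 0 c d * stdCoeff e f g) := by
  decide +kernel

theorem sign_mul_stdCoeff_nonneg (σ : Equiv.Perm (Fin 7)) :
    0 ≤ (Equiv.Perm.sign σ : ℤ) *
      (stdCoeff 0 (σ 0) (σ 1) * stdCoeff 0 (σ 2) (σ 3) * stdCoeff (σ 4) (σ 5) (σ 6)) := by
  by_cases h1 : stdCoeff 0 (σ 0) (σ 1) = 0
  · simp [h1]
  by_cases h2 : stdCoeff 0 (σ 2) (σ 3) = 0
  · simp [h2]
  by_cases h3 : stdCoeff (σ 4) (σ 5) (σ 6) = 0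
  · simp [h3]
  have := stdCoeff_mul_nonneg (σ 0) (σ 1) h1 (σ 2) (by simp) (σ 3) ⟨by simp, h2⟩
    (σ 4) (by simp) (σ 5) (by simp) (σ 6) ⟨by simp, h3⟩
  have e : (![σ 0, σ 1, σ 2, σ 3, σ 4, σ 5, σ 6] : Fin 7 → Fin 7) = σ := by
    funext i; fin_cases i <;> rfl
  rw [e] at this
  rw [Equiv.Perm.sign_eq_prod_prod_Iio]
  convert this using 2
  simp only [Units.coe_prod]
  refine Finset.prod_congr rfl fun j _ => Finset.prod_congr rfl fun i _ => ?_
  split_ifs <;> rfl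

/-- A permutation contributing to the first entry of the Hitchin matrix. -/
def witnessPerm : Equiv.Perm (Fin 7) where
  toFun := ![1, 2, 3, 4, 0, 5, 6]
  invFun := ![4, 0, 1, 2, 3, 5, 6]
  left_inv := by decide
  right_inv := by decide

theorem hitchinMatrix_stdForm_zero_pos : 0 < hitchinMatrix stdForm 0 0 := by
  have h : hitchinMatrix stdForm 0 0 = (1 / 144 : ℝ) *
      ((∑ σ : Equiv.Perm (Fin 7), (Equiv.Perm.sign σ : ℤ) *
      (stdCoeff 0 (σ 0) (σ 1) * stdCoeff 0 (σ 2) (σ 3) * stdCoeff (σ 4) (σ 5) (σ 6)) : ℤ) : ℝ) := by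
    simp only [hitchinMatrix, Matrix.of_apply, comp_stdForm]
    push_cast
    rfl
  rw [h]
  refine mul_pos (by norm_num) (Int.cast_pos.2 ?_)
  refine Finset.sum_pos' (fun σ _ => sign_mul_stdCoeff_nonneg σ) ⟨witnessPerm, Finset.mem_univ _, ?_⟩
  -- No term is negative, so one nonvanishing term suffices.
  refine lt_of_le_of_ne (sign_mul_stdCoeff_nonneg _) (Ne.symm (mul_ne_zero (Units.ne_zero _) ?_))
  decide +kernel

/-- The sign characters separate distinct indices and kill the off-diagonal entries; the 7-cycle is
transitive and equalises the diagonal. -/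
theorem exists_hitchinMatrix_stdForm : ∃ c : ℝ, 0 < c ∧ hitchinMatrix stdForm = c • 1 := by
  set B := hitchinMatrix stdForm with hB
  have h0 : B 0 0 ≠ 0 := hitchinMatrix_stdForm_zero_pos.ne'
  refine ⟨B 0 0, hitchinMatrix_stdForm_zero_pos, ?_⟩
  have hoff : ∀ m i j, B i j = signChar m i * signChar m j * B i j := by
    intro m i j
    have hs := (isSymmetry_signChar m).hitchinMatrix_stdForm
    simp only [Equiv.Perm.coe_one, id, ← hB] at hs
    have hsq : (signChar m 0 : ℝ) * signChar m 0 = 1 := by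
      unfold signChar; split_ifs <;> norm_num
    have hd : (mat (monomialMap (signChar m) 1)).det = 1 := by
      have := hs 0 0
      rw [hsq, one_mul] at this
      exact mul_right_cancel₀ h0 (by rw [one_mul]; exact this.symm)
    rw [← one_mul (_ * B i j), ← hd]
    exact hs i j
  have hcyc : ∀ i, B (cyclePerm i) (cyclePerm i) = B i i := by
    have hs := isSymmetry_cyclePerm.hitchinMatrix_stdForm
    simp only [← hB, Int.cast_one, one_mul] at hs
    set d := (mat (monomialMap (fun _ => 1) cyclePerm)).det
    -- Once around the cycle gives `d ^ 7 = 1`, and odd powers are injective on the reals.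
    have hd : d = 1 := by
      have e0 : B 1 1 = d * B 0 0 := hs 0 0
      have e1 : B 3 3 = d * B 1 1 := hs 1 1
      have e2 : B 2 2 = d * B 3 3 := hs 3 3
      have e3 : B 5 5 = d * B 2 2 := hs 2 2
      have e4 : B 6 6 = d * B 5 5 := hs 5 5
      have e5 : B 4 4 = d * B 6 6 := hs 6 6
      have e6 : B 0 0 = d * B 4 4 := hs 4 4
      rw [e5, e4, e3, e2, e1, e0] at e6
      have h7 : d ^ 7 = 1 := mul_right_cancel₀ h0 (by linear_combination -e6)
      have : Odd 7 := by decide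
      exact this.strictMono_pow.injective (by simpa using h7)
    intro i
    rw [hs i i, hd, one_mul]
  ext i j
  by_cases hij : i = j
  · subst hij
    have e0 : B 1 1 = B 0 0 := hcyc 0
    have e1 : B 3 3 = B 1 1 := hcyc 1
    have e2 : B 2 2 = B 3 3 := hcyc 3
    have e3 : B 5 5 = B 2 2 := hcyc 2
    have e4 : B 6 6 = B 5 5 := hcyc 5
    have e5 : B 4 4 = B 6 6 := hcyc 6
    simp only [Matrix.smul_apply, Matrix.one_apply_eq, smul_eq_mul, mul_one]
    fin_cases i <;> simp only [Fin.reduceFinMk, Fin.zero_eta, Fin.mk_one, Fin.isValue] <;> linarith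
  · have : ∀ i j : Fin 7, i ≠ j → ∃ m, signChar m i * signChar m j = -1 := by decide
    obtain ⟨m, hm⟩ := this i j hij
    have h := hoff m i j
    have hm' : (signChar m i : ℝ) * signChar m j = -1 := by exact_mod_cast hm
    rw [hm'] at h
    simp [hij]
    linarith

/-! ### Invariant functionals -/

/-- A triple of distinct labels either has nonzero sum in `(ℤ/2)³`, detected by a character, or is a
line; the 7-cycle permutes the seven lines transitively. -/
theorem exists_stdCoeff_orbit : ∀ i j k : Fin 7,
    (∃ m, signChar m i * signChar m j * signChar m k = -1) ∨
    (i = j ∨ j = k ∨ i = k) ∨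
    ∃ n : Fin 7, ∃ σ : Equiv.Perm (Fin 3), ∀ a,
      (![i, j, k] : Fin 3 → Fin 7) a = cyclePerm^[n] ((![0, 1, 2] : Fin 3 → Fin 7) (σ a)) := by
  decide +kernel

theorem dx_comp_perm {k : ℕ} (J : Fin k → Fin 7) (σ : Equiv.Perm (Fin k)) :
    dx (fun a => J (σ a)) = ((Equiv.Perm.sign σ : ℤ) : ℝ) • dx J := by
  ext v
  rw [ContinuousAlternatingMap.smul_apply, dx_apply, dx_apply, smul_eq_mul,
    ← Matrix.det_permute']
  rfl

/-- A linear functional on 3-forms which is invariant under the symmetries of the standard form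
is a multiple of the inner product with it. -/
theorem exists_invariant_functional (l : (R7 [⋀^Fin 3]→L[ℝ] ℝ) →L[ℝ] ℝ)
    (hl : ∀ s ρ, IsSymmetry s ρ → ∀ ψ, l (pull ψ (monomialMap s ρ)) = l ψ) :
    ∃ u : ℝ, ∀ ψ, l ψ = u * ∑ J : Fin 3 → Fin 7, comp stdForm J * comp ψ J := by
  -- Both sides obey the same symmetries in `J`, so along the three cases of the orbit lemma they
  -- vanish together or reduce to `J = ![0, 1, 2]`.
  have key : ∀ J, l (dx J) = l (dx ![0, 1, 2]) * comp stdForm J := by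
    intro J
    have h1 : ∀ m (J : Fin 3 → Fin 7),
        signChar m (J 0) * signChar m (J 1) * signChar m (J 2) = -1 →
        l (dx J) = 0 ∧ comp stdForm J = 0 := by
      intro m J h
      have h' : (∏ a, (signChar m (J a) : ℝ)) = -1 := by
        rw [Fin.prod_univ_three]; exact_mod_cast h
      constructor
      · have := hl _ _ (isSymmetry_signChar m) (dx J)
        rw [pull_dx_monomialMap, h', map_smul] at this
        simp only [Equiv.Perm.coe_one, id, smul_eq_mul] at this
        linarith
      · have := comp_pull_monomialMap stdForm (signChar m) 1 J
        rw [(isSymmetry_signChar m).pull_stdForm, h'] at this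
        simp only [Equiv.Perm.coe_one, id] at this
        linarith
    have h2 : ∀ a b, J a = J b → a ≠ b → l (dx J) = 0 ∧ comp stdForm J = 0 := by
      intro a b h hab
      have hz : dx J = 0 := by
        ext v
        rw [dx_apply]
        exact Matrix.det_zero_of_column_eq hab (fun i => by simp [h])
      constructor
      · rw [hz, map_zero]
      · exact stdForm.map_eq_zero_of_eq _ (by rw [h]) hab
    have h3 : ∀ n : ℕ, ∀ J : Fin 3 → Fin 7, l (dx fun a => cyclePerm^[n] (J a)) = l (dx J) ∧
        comp stdForm (fun a => cyclePerm^[n] (J a)) = comp stdForm J := by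
      intro n
      induction n with
      | zero => intro J; exact ⟨rfl, rfl⟩
      | succ n ih =>
        intro J
        have e := ih fun a => cyclePerm (J a)
        simp only [Function.iterate_succ, Function.comp_apply]
        rw [e.1, e.2]
        constructor
        · have := hl _ _ isSymmetry_cyclePerm (dx J)
          rw [pull_dx_monomialMap] at this
          simpa using this
        · have := comp_pull_monomialMap stdForm (fun _ => 1) cyclePerm J
          rw [isSymmetry_cyclePerm.pull_stdForm] at this
          simpa using this
    have hstd : comp stdForm ![0, 1, 2] = 1 := by
      rw [comp_stdForm]
      have : stdCoeff 0 1 2 = 1 := by decide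
      rw [this, Int.cast_one]
    rcases exists_stdCoeff_orbit (J 0) (J 1) (J 2) with ⟨m, hm⟩ | h | ⟨n, σ, h⟩
    · rw [(h1 m J hm).1, (h1 m J hm).2, mul_zero]
    · have : l (dx J) = 0 ∧ comp stdForm J = 0 := by
        rcases h with h | h | h
        · exact h2 0 1 h (by decide)
        · exact h2 1 2 h (by decide)
        · exact h2 0 2 h (by decide)
      rw [this.1, this.2, mul_zero]
    · rw [← fin_three_eta] at h
      have hJ : J = fun a => cyclePerm^[n] ((![0, 1, 2] ∘ σ) a) := funext h
      rw [hJ, (h3 n _).1, (h3 n _).2, comp_comp_perm, hstd]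
      have := dx_comp_perm ![0, 1, 2] σ
      change dx (![0, 1, 2] ∘ σ) = _ at this
      rw [this, map_smul, smul_eq_mul]
      ring
  generalize l (dx ![0, 1, 2]) = u at key
  refine ⟨1 / 6 * u, fun ψ => ?_⟩
  conv_lhs => rw [← sum_comp_smul_dx ψ]
  rw [map_smul, map_sum]
  simp only [map_smul, key, smul_eq_mul]
  rw [Finset.mul_sum, Finset.mul_sum]
  refine Finset.sum_congr rfl fun J _ => ?_
  have h6 : ((Nat.factorial 3 : ℕ) : ℝ) = 6 := by norm_num [Nat.factorial]
  rw [h6]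
  ring

/-! ### The metric of a positive form -/

theorem real_sign_mul (x y : ℝ) : Real.sign (x * y) = Real.sign x * Real.sign y := by
  rcases lt_trichotomy x 0 with hx | rfl | hx
  · rcases lt_trichotomy y 0 with hy | rfl | hy
    · rw [Real.sign_of_neg hx, Real.sign_of_neg hy, Real.sign_of_pos (mul_pos_of_neg_of_neg hx hy)]
      norm_num
    · simp
    · rw [Real.sign_of_neg hx, Real.sign_of_pos hy, Real.sign_of_neg (mul_neg_of_neg_of_pos hx hy)]
      norm_num
  · simp
  · rcases lt_trichotomy y 0 with hy | rfl | hy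
    · rw [Real.sign_of_pos hx, Real.sign_of_neg hy, Real.sign_of_neg (mul_neg_of_pos_of_neg hx hy)]
      norm_num
    · simp
    · rw [Real.sign_of_pos hx, Real.sign_of_pos hy, Real.sign_of_pos (mul_pos hx hy)]
      norm_num

theorem sign_mul_abs_rpow_pow_nine (d : ℝ) :
    Real.sign (d ^ 9) * |d ^ 9| ^ (1 / 9 : ℝ) = d := by
  have h : |d ^ 9| ^ (1 / 9 : ℝ) = |d| := by
    rw [abs_pow, ← Real.rpow_natCast, ← Real.rpow_mul (abs_nonneg d)]
    norm_num
  rw [h]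
  rcases lt_trichotomy d 0 with hd | rfl | hd
  · have : d ^ 9 < 0 := Odd.pow_neg (by decide) hd
    rw [Real.sign_of_neg this, abs_of_neg hd]; ring
  · simp
  · rw [Real.sign_of_pos (by positivity), abs_of_pos hd, one_mul]

theorem volCoeff_of_det_eq {φ χ : R7 [⋀^Fin 3]→L[ℝ] ℝ} {d : ℝ}
    (h : (hitchinMatrix χ).det = d ^ 9 * (hitchinMatrix φ).det) :
    volCoeff χ = d * volCoeff φ := by
  rw [volCoeff, h, real_sign_mul, abs_mul, Real.mul_rpow (abs_nonneg _) (abs_nonneg _), volCoeff]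
  conv_rhs => rw [← sign_mul_abs_rpow_pow_nine d]
  ring

theorem volCoeff_pull (φ : R7 [⋀^Fin 3]→L[ℝ] ℝ) (A : R7 →L[ℝ] R7) :
    volCoeff (pull φ A) = (mat A).det * volCoeff φ :=
  volCoeff_of_det_eq (det_hitchinMatrix_pull φ A)

theorem metric_pull (φ : R7 [⋀^Fin 3]→L[ℝ] ℝ) (A : R7 →L[ℝ] R7) (hA : (mat A).det ≠ 0) :
    metric (pull φ A) = (mat A).transpose * metric φ * mat A := by
  rw [metric, metric, volCoeff_pull, hitchinMatrix_pull, smul_smul, Matrix.mul_smul,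
    Matrix.smul_mul]
  congr 1
  field_simp

theorem volCoeff_ne_zero {φ : R7 [⋀^Fin 3]→L[ℝ] ℝ} (h : (hitchinMatrix φ).det ≠ 0) :
    volCoeff φ ≠ 0 := by
  refine mul_ne_zero (mt Real.sign_eq_zero_iff.1 h) ?_
  exact (Real.rpow_pos_of_pos (abs_pos.2 h) _).ne'

theorem det_hitchinMatrix_stdForm_pos : 0 < (hitchinMatrix stdForm).det := by
  obtain ⟨c, hc, h⟩ := exists_hitchinMatrix_stdForm
  rw [h, Matrix.det_smul, Matrix.det_one, mul_one]
  positivity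

theorem exists_metric_stdForm : ∃ c : ℝ, 0 < c ∧ metric stdForm = c • 1 := by
  obtain ⟨c, hc, h⟩ := exists_hitchinMatrix_stdForm
  have hv : 0 < volCoeff stdForm := by
    rw [volCoeff, Real.sign_of_pos det_hitchinMatrix_stdForm_pos, one_mul]
    exact Real.rpow_pos_of_pos (abs_pos.2 det_hitchinMatrix_stdForm_pos.ne') _
  refine ⟨(volCoeff stdForm)⁻¹ * c, by positivity, ?_⟩
  rw [metric, h, smul_smul]

/-! ### Adapted frames and the inner product on forms -/

theorem mat_mul_mat_symm (A : R7 ≃L[ℝ] R7) :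
    mat (A : R7 →L[ℝ] R7) * mat (A.symm : R7 →L[ℝ] R7) = 1 := by
  rw [← mat_mul, ← mat_id]
  congr 1
  ext v
  simp

theorem det_mat_ne_zero (A : R7 ≃L[ℝ] R7) : (mat (A : R7 →L[ℝ] R7)).det ≠ 0 := by
  intro h
  have := congrArg Matrix.det (mat_mul_mat_symm A)
  rw [Matrix.det_mul, h, zero_mul, Matrix.det_one] at this
  exact zero_ne_one this

theorem pull_symm_pull {k : ℕ} (α : R7 [⋀^Fin k]→L[ℝ] ℝ) (A : R7 ≃L[ℝ] R7) :
    pull (pull α (A : R7 →L[ℝ] R7)) (A.symm : R7 →L[ℝ] R7) = α := by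
  ext v
  simp only [pull_apply, ContinuousLinearEquiv.coe_coe, ContinuousLinearEquiv.apply_symm_apply]

theorem pull_pull_symm {k : ℕ} (α : R7 [⋀^Fin k]→L[ℝ] ℝ) (A : R7 ≃L[ℝ] R7) :
    pull (pull α (A.symm : R7 →L[ℝ] R7)) (A : R7 →L[ℝ] R7) = α := by
  ext v
  simp only [pull_apply, ContinuousLinearEquiv.coe_coe, ContinuousLinearEquiv.symm_apply_apply]

/-- If `g⁻¹ = ∑ r_m ⊗ r_m`, the inner product of forms is computed in the frame `r`. -/
theorem formInner_eq_frame {k : ℕ} (φ : R7 [⋀^Fin 3]→L[ℝ] ℝ) (r : Fin 7 → R7)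
    (hr : ∀ i j, (metric φ)⁻¹ i j = ∑ m, r m i * r m j) (α β : R7 [⋀^Fin k]→L[ℝ] ℝ) :
    formInner φ α β = (1 / (k.factorial : ℝ)) *
      ∑ K : Fin k → Fin 7, (α fun a => r (K a)) * β fun a => r (K a) := by
  rw [formInner]
  congr 1
  have h : ∀ I J : Fin k → Fin 7, invMetric φ I J =
      ∑ K : Fin k → Fin 7, (∏ a, r (K a) (I a)) * ∏ a, r (K a) (J a) := by
    intro I J
    simp only [invMetric, hr, Fintype.prod_sum, Finset.prod_mul_distrib]
  calc ∑ I, ∑ J, invMetric φ I J * comp α I * comp β J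
      = ∑ I, ∑ J, ∑ K : Fin k → Fin 7,
        ((∏ a, r (K a) (I a)) * comp α I) * ((∏ a, r (K a) (J a)) * comp β J) := by
        refine Finset.sum_congr rfl fun I _ => Finset.sum_congr rfl fun J _ => ?_
        rw [h, Finset.sum_mul, Finset.sum_mul]
        exact Finset.sum_congr rfl fun K _ => by ring
    _ = ∑ K : Fin k → Fin 7, ∑ I, ∑ J,
        ((∏ a, r (K a) (I a)) * comp α I) * ((∏ a, r (K a) (J a)) * comp β J) := by
        exact (Finset.sum_congr rfl fun I _ => Finset.sum_comm).trans Finset.sum_comm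
    _ = _ := by
        refine Finset.sum_congr rfl fun K _ => ?_
        rw [← sum_prod_mul_comp α, ← sum_prod_mul_comp β, Finset.sum_mul_sum]

/-- The inner product induced by a positive form, in an adapted frame. -/
theorem exists_formInner_formula : ∃ ν : ℝ, 0 < ν ∧ ∀ (A : R7 ≃L[ℝ] R7) (k : ℕ)
    (α β : R7 [⋀^Fin k]→L[ℝ] ℝ), formInner (pull stdForm (A : R7 →L[ℝ] R7)) α β =
      (1 / (k.factorial : ℝ)) * (ν ^ (2 * k) * ∑ K : Fin k → Fin 7,
        comp (pull α (A.symm : R7 →L[ℝ] R7)) K * comp (pull β (A.symm : R7 →L[ℝ] R7)) K) := by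
  obtain ⟨c, hc, h⟩ := exists_metric_stdForm
  -- The metric is `c Aᵀ A`, so the vectors `c^(-1/2) A⁻¹ e_m` form an orthonormal frame.
  refine ⟨Real.sqrt c⁻¹, Real.sqrt_pos.2 (inv_pos.2 hc), fun A k α β => ?_⟩
  set ν := Real.sqrt c⁻¹
  have hν : ν * ν = c⁻¹ := Real.mul_self_sqrt (inv_pos.2 hc).le
  have hinv : (metric (pull stdForm (A : R7 →L[ℝ] R7)))⁻¹ =
      c⁻¹ • (mat (A.symm : R7 →L[ℝ] R7) * (mat (A.symm : R7 →L[ℝ] R7)).transpose) := by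
    refine Matrix.inv_eq_right_inv ?_
    rw [metric_pull _ _ (det_mat_ne_zero A), h]
    simp only [Matrix.mul_smul, Matrix.smul_mul, Matrix.mul_one, smul_smul]
    rw [inv_mul_cancel₀ hc.ne', one_smul, Matrix.mul_assoc, ← Matrix.mul_assoc (mat _) (mat _),
      mat_mul_mat_symm, Matrix.one_mul, ← Matrix.transpose_mul]
    have := mat_mul_mat_symm A.symm
    rw [ContinuousLinearEquiv.symm_symm] at this
    rw [this, Matrix.transpose_one]
  rw [formInner_eq_frame _ (fun m => ν • A.symm (stdVec m))]
  · congr 1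
    rw [Finset.mul_sum]
    refine Finset.sum_congr rfl fun K _ => ?_
    have e : ∀ γ : R7 [⋀^Fin k]→L[ℝ] ℝ, (γ fun a => ν • A.symm (stdVec (K a))) =
        ν ^ k * comp (pull γ (A.symm : R7 →L[ℝ] R7)) K := by
      intro γ
      have := γ.toMultilinearMap.map_smul_univ (fun _ => ν) (fun a => A.symm (stdVec (K a)))
      rw [Finset.prod_const, Finset.card_univ, Fintype.card_fin] at this
      exact this
    rw [e, e]
    ring
  · intro i j
    rw [hinv, Matrix.smul_apply, Matrix.mul_apply, smul_eq_mul, Finset.mul_sum]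
    refine Finset.sum_congr rfl fun m _ => ?_
    simp only [mat, Matrix.transpose_apply, Matrix.of_apply, PiLp.smul_apply, smul_eq_mul, ← hν]
    simp only [ContinuousLinearEquiv.coe_coe]
    ring

/-- Positivity of a 3-form on `ℝ⁷`. -/
def IsPos (φ : R7 [⋀^Fin 3]→L[ℝ] ℝ) : Prop :=
  ∃ A : R7 ≃L[ℝ] R7, φ = pull stdForm (A : R7 →L[ℝ] R7)

theorem IsPos.det_ne_zero {φ : R7 [⋀^Fin 3]→L[ℝ] ℝ} (h : IsPos φ) :
    (hitchinMatrix φ).det ≠ 0 := by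
  obtain ⟨A, rfl⟩ := h
  rw [det_hitchinMatrix_pull]
  exact mul_ne_zero (pow_ne_zero _ (det_mat_ne_zero A)) det_hitchinMatrix_stdForm_pos.ne'

theorem IsPos.formInner_comm {φ : R7 [⋀^Fin 3]→L[ℝ] ℝ} (h : IsPos φ) {k : ℕ}
    (α β : R7 [⋀^Fin k]→L[ℝ] ℝ) : formInner φ α β = formInner φ β α := by
  obtain ⟨A, rfl⟩ := h
  obtain ⟨ν, -, hν⟩ := exists_formInner_formula
  rw [hν, hν]
  simp only [mul_comm]

theorem IsPos.formInner_self_nonneg {φ : R7 [⋀^Fin 3]→L[ℝ] ℝ} (h : IsPos φ) {k : ℕ}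
    (α : R7 [⋀^Fin k]→L[ℝ] ℝ) : 0 ≤ formInner φ α α := by
  obtain ⟨A, rfl⟩ := h
  obtain ⟨ν, h0, hν⟩ := exists_formInner_formula
  rw [hν]
  have : 0 ≤ ∑ K : Fin k → Fin 7,
    comp (pull α (A.symm : R7 →L[ℝ] R7)) K * comp (pull α (A.symm : R7 →L[ℝ] R7)) K :=
    Finset.sum_nonneg fun K _ => mul_self_nonneg _
  positivity

theorem formInner_pull_stdForm {k : ℕ} (A : R7 ≃L[ℝ] R7) (α β : R7 [⋀^Fin k]→L[ℝ] ℝ) :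
    formInner (pull stdForm (A : R7 →L[ℝ] R7)) (pull α (A : R7 →L[ℝ] R7))
      (pull β (A : R7 →L[ℝ] R7)) = formInner stdForm α β := by
  obtain ⟨ν, -, hν⟩ := exists_formInner_formula
  have h1 := hν (ContinuousLinearEquiv.refl ℝ R7) k α β
  rw [hν, pull_symm_pull, pull_symm_pull]
  exact h1.symm

/-! ### Smooth dependence on the form -/

theorem contDiff_comp {k : ℕ} {n : ℕ∞} (I : Fin k → Fin 7) :
    ContDiff ℝ n fun α : R7 [⋀^Fin k]→L[ℝ] ℝ => comp α I :=
  (compL I).contDiff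

theorem contDiff_hitchinMatrix {n : ℕ∞} (i j : Fin 7) :
    ContDiff ℝ n fun φ => hitchinMatrix φ i j := by
  simp only [hitchinMatrix, Matrix.of_apply]
  refine contDiff_const.mul (ContDiff.sum fun σ _ => contDiff_const.mul ?_)
  exact ((contDiff_comp _).mul (contDiff_comp _)).mul (contDiff_comp _)

theorem contDiffAt_det {E : Type*} [NormedAddCommGroup E] [NormedSpace ℝ E] {n : ℕ∞}
    {F : E → Matrix (Fin 7) (Fin 7) ℝ} {x : E} (h : ∀ i j, ContDiffAt ℝ n (fun y => F y i j) x) :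
    ContDiffAt ℝ n (fun y => (F y).det) x := by
  simp only [Matrix.det_apply']
  exact ContDiffAt.sum fun σ _ => contDiffAt_const.mul (contDiffAt_prod fun i _ => h _ _)

theorem contDiffAt_inv_apply {E : Type*} [NormedAddCommGroup E] [NormedSpace ℝ E]
    {n : ℕ∞} {F : E → Matrix (Fin 7) (Fin 7) ℝ} {x : E}
    (h : ∀ i j, ContDiffAt ℝ n (fun y => F y i j) x) (h0 : (F x).det ≠ 0) (i j : Fin 7) :
    ContDiffAt ℝ n (fun y => (F y)⁻¹ i j) x := by
  simp only [Matrix.inv_def, Ring.inverse_eq_inv', Matrix.smul_apply, smul_eq_mul,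
    Matrix.adjugate_apply]
  refine ((contDiffAt_det h).inv h0).mul (contDiffAt_det fun k l => ?_)
  simp only [Matrix.updateRow_apply]
  split_ifs
  · exact contDiffAt_const
  · exact h k l

theorem contDiff_det_hitchinMatrix {n : ℕ∞} :
    ContDiff ℝ n fun φ => (hitchinMatrix φ).det :=
  contDiff_iff_contDiffAt.2 fun _ => contDiffAt_det fun i j => (contDiff_hitchinMatrix i j).contDiffAt

/-- Where the determinant is nonzero its sign is locally constant, and the power of its absolute
value is smooth. -/
theorem contDiffAt_volCoeff {n : ℕ∞} {φ : R7 [⋀^Fin 3]→L[ℝ] ℝ}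
    (h : (hitchinMatrix φ).det ≠ 0) : ContDiffAt ℝ n volCoeff φ := by
  have hd := (contDiff_det_hitchinMatrix (n := n)).contDiffAt (x := φ)
  have hf : ContDiffAt ℝ n (fun χ => Real.sign (hitchinMatrix φ).det *
      |(hitchinMatrix χ).det| ^ (1 / 9 : ℝ)) φ :=
    contDiffAt_const.mul ((hd.abs h).rpow_const_of_ne (abs_ne_zero.2 h))
  refine hf.congr_of_eventuallyEq ?_
  have hc := hd.continuousAt
  rcases lt_or_gt_of_ne h with h | h
  · filter_upwards [hc.eventually_lt continuousAt_const h] with χ hχ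
    rw [volCoeff, Real.sign_of_neg hχ, Real.sign_of_neg h]
  · filter_upwards [continuousAt_const.eventually_lt hc h] with χ hχ
    rw [volCoeff, Real.sign_of_pos hχ, Real.sign_of_pos h]

theorem contDiffAt_metric {n : ℕ∞} {φ : R7 [⋀^Fin 3]→L[ℝ] ℝ}
    (h : (hitchinMatrix φ).det ≠ 0) (i j : Fin 7) : ContDiffAt ℝ n (fun χ => metric χ i j) φ := by
  simp only [metric, Matrix.smul_apply, smul_eq_mul]
  exact ((contDiffAt_volCoeff h).inv (volCoeff_ne_zero h)).mul
    (contDiff_hitchinMatrix i j).contDiffAt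

theorem det_metric_ne_zero {φ : R7 [⋀^Fin 3]→L[ℝ] ℝ} (h : (hitchinMatrix φ).det ≠ 0) :
    (metric φ).det ≠ 0 := by
  rw [metric, Matrix.det_smul]
  exact mul_ne_zero (pow_ne_zero _ (inv_ne_zero (volCoeff_ne_zero h))) h

theorem contDiffAt_invMetric {n : ℕ∞} {φ : R7 [⋀^Fin 3]→L[ℝ] ℝ}
    (h : (hitchinMatrix φ).det ≠ 0) {k : ℕ} (I J : Fin k → Fin 7) :
    ContDiffAt ℝ n (fun χ => invMetric χ I J) φ :=
  contDiffAt_prod fun _ _ =>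
    contDiffAt_inv_apply (fun i j => contDiffAt_metric h i j) (det_metric_ne_zero h) _ _

/-! ### Scaling -/

theorem hitchinMatrix_smul (c : ℝ) (φ : R7 [⋀^Fin 3]→L[ℝ] ℝ) :
    hitchinMatrix (c • φ) = c ^ 3 • hitchinMatrix φ := by
  ext i j
  simp only [hitchinMatrix, Matrix.of_apply, Matrix.smul_apply, comp_smul, smul_eq_mul,
    Finset.mul_sum]
  exact Finset.sum_congr rfl fun σ _ => by ring

/-- The Hitchin matrix is cubic, so its determinant has degree 21, and `21 / 9 = 7 / 3`. -/
theorem volCoeff_smul {c : ℝ} (hc : 0 < c) (φ : R7 [⋀^Fin 3]→L[ℝ] ℝ) :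
    volCoeff (c • φ) = c ^ (7 / 3 : ℝ) * volCoeff φ := by
  refine volCoeff_of_det_eq ?_
  rw [hitchinMatrix_smul, Matrix.det_smul, Fintype.card_fin, ← pow_mul, ← Real.rpow_natCast,
    ← Real.rpow_natCast, ← Real.rpow_mul hc.le]
  norm_num

theorem metric_smul {c : ℝ} (hc : 0 < c) (φ : R7 [⋀^Fin 3]→L[ℝ] ℝ) :
    metric (c • φ) = c ^ (2 / 3 : ℝ) • metric φ := by
  rw [metric, metric, volCoeff_smul hc, hitchinMatrix_smul, smul_smul, smul_smul]
  congr 1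
  have : c ^ (2 / 3 : ℝ) * c ^ (7 / 3 : ℝ) = c ^ 3 := by
    rw [← Real.rpow_add hc, ← Real.rpow_natCast]; norm_num
  have h7 : c ^ (7 / 3 : ℝ) ≠ 0 := (Real.rpow_pos_of_pos hc _).ne'
  rw [mul_inv, ← this]
  field_simp

theorem inv_metric_smul {c : ℝ} (hc : 0 < c) (φ : R7 [⋀^Fin 3]→L[ℝ] ℝ) :
    (metric (c • φ))⁻¹ = c ^ (-(2 / 3) : ℝ) • (metric φ)⁻¹ := by
  have h0 : c ^ (2 / 3 : ℝ) ≠ 0 := (Real.rpow_pos_of_pos hc _).ne'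
  rw [metric_smul hc, Real.rpow_neg hc.le]
  by_cases h : IsUnit (metric φ).det
  · exact Matrix.inv_smul' (metric φ) (Units.mk0 _ h0) h
  -- The inverse of a singular matrix is zero by convention, so both sides vanish and no positivity
  -- of `φ` is needed.
  · have h' : ¬ IsUnit (c ^ (2 / 3 : ℝ) • metric φ).det := by
      rw [Matrix.det_smul]
      intro hu
      exact h (isUnit_of_mul_isUnit_right hu)
    rw [Matrix.nonsing_inv_apply_not_isUnit _ h, Matrix.nonsing_inv_apply_not_isUnit _ h',
      smul_zero]

theorem invMetric_smul {c : ℝ} (hc : 0 < c) (φ : R7 [⋀^Fin 3]→L[ℝ] ℝ) {k : ℕ}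
    (I J : Fin k → Fin 7) :
    invMetric (c • φ) I J = (c ^ (-(2 / 3) : ℝ)) ^ k * invMetric φ I J := by
  simp only [invMetric, inv_metric_smul hc, Matrix.smul_apply, smul_eq_mul,
    Finset.prod_mul_distrib, Finset.prod_const, Finset.card_univ, Fintype.card_fin]

/-! ### The volume functional -/

/-- The density of the volume form. -/
def absVol (φ : R7 [⋀^Fin 3]→L[ℝ] ℝ) : ℝ := |volCoeff φ|

theorem absVol_pull (φ : R7 [⋀^Fin 3]→L[ℝ] ℝ) (A : R7 →L[ℝ] R7) :
    absVol (pull φ A) = |(mat A).det| * absVol φ := by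
  rw [absVol, volCoeff_pull, abs_mul, absVol]

theorem absVol_pos {φ : R7 [⋀^Fin 3]→L[ℝ] ℝ} (h : (hitchinMatrix φ).det ≠ 0) : 0 < absVol φ :=
  abs_pos.2 (volCoeff_ne_zero h)

theorem contDiffAt_absVol {n : ℕ∞} {φ : R7 [⋀^Fin 3]→L[ℝ] ℝ}
    (h : (hitchinMatrix φ).det ≠ 0) : ContDiffAt ℝ n absVol φ :=
  (contDiffAt_volCoeff h).abs (volCoeff_ne_zero h)

theorem differentiableAt_absVol {φ : R7 [⋀^Fin 3]→L[ℝ] ℝ} (h : (hitchinMatrix φ).det ≠ 0) :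
    DifferentiableAt ℝ absVol φ :=
  (contDiffAt_absVol (n := 1) h).differentiableAt (by norm_num)

theorem absVol_smul {c : ℝ} (hc : 0 < c) (φ : R7 [⋀^Fin 3]→L[ℝ] ℝ) :
    absVol (c • φ) = c ^ (7 / 3 : ℝ) * absVol φ := by
  rw [absVol, volCoeff_smul hc, abs_mul, abs_of_pos (Real.rpow_pos_of_pos hc _), absVol]

/-- Euler's identity in degree `7/3`. -/
theorem fderiv_absVol_self {φ : R7 [⋀^Fin 3]→L[ℝ] ℝ} (h : (hitchinMatrix φ).det ≠ 0) :
    fderiv ℝ absVol φ φ = 7 / 3 * absVol φ := by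
  have h1 : HasDerivAt (fun c : ℝ => c • φ) φ 1 := by
    simpa using (hasDerivAt_id (1 : ℝ)).smul_const φ
  have h2 : HasFDerivAt absVol (fderiv ℝ absVol φ) ((1 : ℝ) • φ) := by
    rw [one_smul]; exact (differentiableAt_absVol h).hasFDerivAt
  have h3 := h2.comp_hasDerivAt (1 : ℝ) h1
  have h4 : HasDerivAt (fun c : ℝ => c ^ (7 / 3 : ℝ) * absVol φ) (7 / 3 * absVol φ) 1 := by
    have := (Real.hasDerivAt_rpow_const (x := 1) (p := 7 / 3) (Or.inl one_ne_zero)).mul_const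
      (absVol φ)
    simpa using this
  refine h3.unique (h4.congr_of_eventuallyEq ?_)
  filter_upwards [lt_mem_nhds (zero_lt_one' ℝ)] with c hc
  exact absVol_smul hc φ

theorem fderiv_absVol_pull {φ : R7 [⋀^Fin 3]→L[ℝ] ℝ} (A : R7 →L[ℝ] R7)
    (h : (hitchinMatrix φ).det ≠ 0) (hA : (hitchinMatrix (pull φ A)).det ≠ 0)
    (ψ : R7 [⋀^Fin 3]→L[ℝ] ℝ) :
    fderiv ℝ absVol (pull φ A) (pull ψ A) = |(mat A).det| * fderiv ℝ absVol φ ψ := by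
  let P : (R7 [⋀^Fin 3]→L[ℝ] ℝ) →L[ℝ] (R7 [⋀^Fin 3]→L[ℝ] ℝ) :=
    ContinuousAlternatingMap.compContinuousLinearMapCLM A
  have h1 : HasFDerivAt (absVol ∘ P) ((fderiv ℝ absVol (P φ)).comp P) φ :=
    (differentiableAt_absVol hA).hasFDerivAt.comp φ P.hasFDerivAt
  have h2 : HasFDerivAt (absVol ∘ P) (|(mat A).det| • fderiv ℝ absVol φ) φ := by
    have := (differentiableAt_absVol h).hasFDerivAt.const_smul |(mat A).det|
    refine this.congr_of_eventuallyEq (Filter.Eventually.of_forall fun χ => ?_)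
    exact absVol_pull χ A
  have := h1.unique h2
  exact DFunLike.congr_fun this ψ

/-- The derivative of the volume density at a positive form `φ` is a positive multiple of
`⟨φ, ·⟩_φ vol_φ`. -/
theorem exists_fderiv_absVol : ∃ κ : ℝ, 0 < κ ∧ ∀ φ : R7 [⋀^Fin 3]→L[ℝ] ℝ, IsPos φ →
    ∀ ψ, fderiv ℝ absVol φ ψ = κ * (formInner φ φ ψ * absVol φ) := by
  have hd : (hitchinMatrix stdForm).det ≠ 0 := det_hitchinMatrix_stdForm_pos.ne'
  have hv : 0 < absVol stdForm := absVol_pos hd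
  obtain ⟨ν, hν0, hν⟩ := exists_formInner_formula
  -- A symmetry fixes the standard form and hence its nonzero volume, so its determinant is `±1` and
  -- the derivative is invariant.
  obtain ⟨u, hu⟩ := exists_invariant_functional (fderiv ℝ absVol stdForm) (by
    intro s ρ hs ψ
    have h := hs.pull_stdForm
    have h1 : |(mat (monomialMap s ρ)).det| = 1 := by
      have := absVol_pull stdForm (monomialMap s ρ)
      rw [h] at this
      exact mul_right_cancel₀ hv.ne' (by rw [one_mul]; exact this.symm)
    have h2 := fderiv_absVol_pull (monomialMap s ρ) hd (by rw [h]; exact hd) ψ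
    rwa [h, h1, one_mul] at h2)
  have hstd : ∀ ψ, fderiv ℝ absVol stdForm ψ =
      (u * 6 / ν ^ 6 / absVol stdForm) * (formInner stdForm stdForm ψ * absVol stdForm) := by
    intro ψ
    have e : formInner stdForm stdForm ψ = 1 / ((Nat.factorial 3 : ℕ) : ℝ) * (ν ^ (2 * 3) *
        ∑ J : Fin 3 → Fin 7, comp stdForm J * comp ψ J) :=
      hν (ContinuousLinearEquiv.refl ℝ R7) 3 stdForm ψ
    have h6 : ((Nat.factorial 3 : ℕ) : ℝ) = 6 := by norm_num [Nat.factorial]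
    rw [hu, e, h6]
    field_simp
  set κ := u * 6 / ν ^ 6 / absVol stdForm
  refine ⟨κ, ?_, ?_⟩
  -- In the direction of the form itself the derivative is positive and the inner product is
  -- nonnegative, so `κ > 0`.
  · have h1 := hstd stdForm
    rw [fderiv_absVol_self hd] at h1
    have h2 : 0 ≤ formInner stdForm stdForm stdForm * absVol stdForm := by
      refine mul_nonneg (IsPos.formInner_self_nonneg ⟨ContinuousLinearEquiv.refl ℝ R7, rfl⟩ _) hv.le
    have h3 : 0 < κ * (formInner stdForm stdForm stdForm * absVol stdForm) := by
      rw [← h1]; positivity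
    exact pos_of_mul_pos_left h3 h2
  -- Both sides pick up the factor `|det A|` under pullback.
  · rintro φ ⟨A, rfl⟩ ψ
    have h1 := fderiv_absVol_pull (A : R7 →L[ℝ] R7) hd (IsPos.det_ne_zero ⟨A, rfl⟩)
      (pull ψ (A.symm : R7 →L[ℝ] R7))
    rw [pull_pull_symm] at h1
    have h2 := formInner_pull_stdForm A stdForm (pull ψ (A.symm : R7 →L[ℝ] R7))
    rw [pull_pull_symm] at h2
    rw [h1, hstd, h2, absVol_pull]
    ring

/-! ### The energy density as a function of the 1-jet -/

section Smooth

variable {E : Type*} [NormedAddCommGroup E] [NormedSpace ℝ E] {n : ℕ∞}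
  {φ : E → R7 [⋀^Fin 3]→L[ℝ] ℝ} {x : E}

theorem contDiffAt_invMetric_comp (hφ : ContDiffAt ℝ n φ x) (h : (hitchinMatrix (φ x)).det ≠ 0) {k : ℕ}
    (I J : Fin k → Fin 7) : ContDiffAt ℝ n (fun y => invMetric (φ y) I J) x :=
  (contDiffAt_invMetric h I J).comp x hφ

theorem contDiffAt_comp_form {k : ℕ} {α : E → R7 [⋀^Fin k]→L[ℝ] ℝ} (hα : ContDiffAt ℝ n α x)
    (I : Fin k → Fin 7) : ContDiffAt ℝ n (fun y => comp (α y) I) x :=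
  (contDiff_comp I).contDiffAt.comp x hα

theorem contDiffAt_formInner (hφ : ContDiffAt ℝ n φ x) (h : (hitchinMatrix (φ x)).det ≠ 0) {k : ℕ}
    {α β : E → R7 [⋀^Fin k]→L[ℝ] ℝ} (hα : ContDiffAt ℝ n α x) (hβ : ContDiffAt ℝ n β x) :
    ContDiffAt ℝ n (fun y => formInner (φ y) (α y) (β y)) x :=
  contDiffAt_const.mul (ContDiffAt.sum fun I _ => ContDiffAt.sum fun J _ =>
    ((contDiffAt_invMetric_comp hφ h I J).mul (contDiffAt_comp_form hα I)).mul
      (contDiffAt_comp_form hβ J))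

theorem contDiffAt_hodgeStar (hφ : ContDiffAt ℝ n φ x) (h : (hitchinMatrix (φ x)).det ≠ 0)
    {k l : ℕ} (hkl : k + l = 7) {α : E → R7 [⋀^Fin k]→L[ℝ] ℝ} (hα : ContDiffAt ℝ n α x) :
    ContDiffAt ℝ n (fun y => hodgeStar hkl (φ y) (α y)) x := by
  have hv : ContDiffAt ℝ n (fun y => volCoeff (φ y)) x := (contDiffAt_volCoeff h).comp x hφ
  simp only [hodgeStar]
  apply ContDiffAt.const_smul
  apply ContDiffAt.sum
  intro J _
  suffices hc : ContDiffAt ℝ n (fun y => 1 / (k.factorial : ℝ) * volCoeff (φ y) *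
      ∑ I, ∑ I', invMetric (φ y) I I' * comp (α y) I' * leviCivita hkl I J) x from
    hc.smul contDiffAt_const
  refine (contDiffAt_const.mul hv).mul (ContDiffAt.sum fun I _ => ContDiffAt.sum fun I' _ => ?_)
  exact ((contDiffAt_invMetric_comp hφ h I I').mul (contDiffAt_comp_form hα I')).mul contDiffAt_const

end Smooth

/-- The 4-form `⋆_φ φ`. -/
def starSelf (φ : R7 [⋀^Fin 3]→L[ℝ] ℝ) : R7 [⋀^Fin 4]→L[ℝ] ℝ :=
  hodgeStar (k := 3) (l := 4) rfl φ φ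

theorem contDiffAt_starSelf {n : ℕ∞} {φ : R7 [⋀^Fin 3]→L[ℝ] ℝ} (h : (hitchinMatrix φ).det ≠ 0) :
    ContDiffAt ℝ n starSelf φ :=
  contDiffAt_hodgeStar contDiffAt_id h rfl contDiffAt_id

attribute [irreducible] starSelf

/-- The space of 1-jets of 3-forms on `ℝ⁷`. -/
abbrev Jet : Type := (R7 [⋀^Fin 3]→L[ℝ] ℝ) × (R7 →L[ℝ] R7 [⋀^Fin 3]→L[ℝ] ℝ)

/-- Alternatization as a continuous linear map. -/
abbrev altL (k : ℕ) :
    (R7 →L[ℝ] R7 [⋀^Fin k]→L[ℝ] ℝ) →L[ℝ] (R7 [⋀^Fin (k + 1)]→L[ℝ] ℝ) :=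
  ContinuousAlternatingMap.alternatizeUncurryFinCLM ℝ R7 ℝ

theorem altL_apply {k : ℕ} (L : R7 →L[ℝ] R7 [⋀^Fin k]→L[ℝ] ℝ) :
    altL k L = ContinuousAlternatingMap.alternatizeUncurryFin L := rfl

theorem contDiffAt_altL {E : Type*} [NormedAddCommGroup E] [NormedSpace ℝ E] {n : ℕ∞} {k : ℕ}
    {L : E → R7 →L[ℝ] R7 [⋀^Fin k]→L[ℝ] ℝ} {x : E} (hL : ContDiffAt ℝ n L x) :
    ContDiffAt ℝ n (fun y => altL k (L y)) x := by
  have h := ContinuousLinearMap.contDiff (n := n) (𝕜 := ℝ) (E := R7 →L[ℝ] R7 [⋀^Fin k]→L[ℝ] ℝ)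
    (F := R7 [⋀^Fin (k + 1)]→L[ℝ] ℝ) (altL k)
  exact h.contDiffAt.comp x hL

/-- The codifferential in terms of the 1-jet. -/
def jetCodiff (p : Jet) : R7 [⋀^Fin 2]→L[ℝ] ℝ :=
  -hodgeStar (k := 5) (l := 2) rfl p.1 (altL 4 ((fderiv ℝ starSelf p.1).comp p.2))

/-- The energy density in terms of the 1-jet. -/
def jetEnergy (p : Jet) : ℝ :=
  (1 / 2 : ℝ) * (formInner p.1 (altL 3 p.2) (altL 3 p.2)
    + formInner p.1 (jetCodiff p) (jetCodiff p)) * absVol p.1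

theorem contDiffAt_jetEnergy {p : Jet} (h : (hitchinMatrix p.1).det ≠ 0) :
    ContDiffAt ℝ ∞ jetEnergy p := by
  have h1 : ContDiffAt ℝ ∞ (fun q : Jet => q.1) p := contDiffAt_fst
  have h2 : ContDiffAt ℝ ∞ (fun q : Jet => q.2) p := contDiffAt_snd
  have h3 : ContDiffAt ℝ ∞ (fun q : Jet => altL 3 q.2) p :=
    contDiffAt_altL h2
  have h4 : ContDiffAt ℝ ∞ (fun q : Jet => fderiv ℝ starSelf q.1) p :=
    ((contDiffAt_starSelf (n := ⊤) h).fderiv_right (m := ∞) (by rfl)).comp p h1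
  have h5 : ContDiffAt ℝ ∞ (fun q : Jet => altL 4 ((fderiv ℝ starSelf q.1).comp q.2)) p :=
    contDiffAt_altL (h4.clm_comp h2)
  have h6 : ContDiffAt ℝ ∞ jetCodiff p := (contDiffAt_hodgeStar h1 h rfl h5).neg
  exact (contDiffAt_const.mul ((contDiffAt_formInner h1 h h3 h3).add
    (contDiffAt_formInner h1 h h6 h6))).mul ((contDiffAt_absVol h).comp p h1)

/-- By the chain rule, `d(⋆φ)` involves only the value and first derivative of `φ`. -/
theorem energyDensity_eq_jetEnergy {φ : R7 → R7 [⋀^Fin 3]→L[ℝ] ℝ} {y : R7}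
    (hφ : DifferentiableAt ℝ φ y) (h : (hitchinMatrix (φ y)).det ≠ 0) :
    energyDensity φ y = jetEnergy (φ y, fderiv ℝ φ y) := by
  have h1 : fderiv ℝ (fun z => hodgeStar (k := 3) (l := 4) rfl (φ z) (φ z)) y =
      (fderiv ℝ starSelf (φ y)).comp (fderiv ℝ φ y) := by
    have h0 : (fun z => hodgeStar (k := 3) (l := 4) rfl (φ z) (φ z)) = starSelf ∘ φ := by
      funext z; rw [Function.comp_apply, starSelf]
    rw [h0]
    have h1 : DifferentiableAt ℝ starSelf (φ y) :=
      (contDiffAt_starSelf (n := 1) h).differentiableAt (by norm_num)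
    exact fderiv_comp y h1 hφ
  have h2 : codiff φ y = jetCodiff (φ y, fderiv ℝ φ y) := by
    rw [codiff, jetCodiff, extDeriv, h1, altL_apply]
  rw [energyDensity, h2, jetEnergy, altL_apply, extDeriv, absVol]

theorem energyDensity_nonneg {φ : R7 → R7 [⋀^Fin 3]→L[ℝ] ℝ} {y : R7} (h : IsPos (φ y)) :
    0 ≤ energyDensity φ y := by
  have h1 := h.formInner_self_nonneg (extDeriv φ y)
  have h2 := h.formInner_self_nonneg (codiff φ y)
  rw [energyDensity]
  positivity

/-! ### Homogeneity of the energy density -/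

/-- Scaling forms by cubes makes all weights integral: 2 for the metric, 7 for the volume, 5 for the
energy. -/
theorem cube_rpow {a : ℝ} (ha : 0 < a) (p : ℝ) : (a ^ 3) ^ p = a ^ (3 * p) := by
  rw [← Real.rpow_natCast, ← Real.rpow_mul ha.le]
  norm_num

theorem volCoeff_cube_smul {a : ℝ} (ha : 0 < a) (φ : R7 [⋀^Fin 3]→L[ℝ] ℝ) :
    volCoeff (a ^ 3 • φ) = a ^ 7 * volCoeff φ := by
  rw [volCoeff_smul (pow_pos ha 3), cube_rpow ha, ← Real.rpow_natCast a 7]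
  norm_num

theorem invMetric_cube_smul {a : ℝ} (ha : 0 < a) (φ : R7 [⋀^Fin 3]→L[ℝ] ℝ) {k : ℕ}
    (I J : Fin k → Fin 7) :
    invMetric (a ^ 3 • φ) I J = ((a ^ 2)⁻¹) ^ k * invMetric φ I J := by
  rw [invMetric_smul (pow_pos ha 3), cube_rpow ha, ← Real.rpow_natCast a 2, ← Real.rpow_neg ha.le]
  norm_num

theorem hodgeStar_cube_smul {a : ℝ} (ha : 0 < a) (φ : R7 [⋀^Fin 3]→L[ℝ] ℝ) {k l : ℕ}
    (h : k + l = 7) (b : ℝ) (α : R7 [⋀^Fin k]→L[ℝ] ℝ) :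
    hodgeStar h (a ^ 3 • φ) (b • α) = (a ^ 7 * ((a ^ 2)⁻¹) ^ k * b) • hodgeStar h φ α := by
  rw [hodgeStar, hodgeStar, smul_comm (a ^ 7 * ((a ^ 2)⁻¹) ^ k * b) (1 / (l.factorial : ℝ))]
  congr 1
  rw [Finset.smul_sum]
  refine Finset.sum_congr rfl fun J _ => ?_
  rw [smul_smul]
  congr 1
  rw [volCoeff_cube_smul ha]
  simp only [invMetric_cube_smul ha, comp_smul, Finset.mul_sum]
  exact Finset.sum_congr rfl fun I _ => Finset.sum_congr rfl fun I' _ => by ring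

theorem formInner_cube_smul {a : ℝ} (ha : 0 < a) (φ : R7 [⋀^Fin 3]→L[ℝ] ℝ) {k : ℕ}
    (b : ℝ) (α β : R7 [⋀^Fin k]→L[ℝ] ℝ) :
    formInner (a ^ 3 • φ) (b • α) (b • β) = (((a ^ 2)⁻¹) ^ k * b ^ 2) * formInner φ α β := by
  rw [formInner, formInner]
  simp only [invMetric_cube_smul ha, comp_smul, Finset.mul_sum]
  exact Finset.sum_congr rfl fun I _ => Finset.sum_congr rfl fun J _ => by ring

theorem extDeriv_const_smul {k : ℕ} (c : ℝ) (α : R7 → R7 [⋀^Fin k]→L[ℝ] ℝ) (y : R7) :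
    extDeriv (fun z => c • α z) y = c • extDeriv α y :=
  extDeriv_smul c α

theorem codiff_cube_smul {a : ℝ} (ha : 0 < a) (φ : R7 → R7 [⋀^Fin 3]→L[ℝ] ℝ) (y : R7) :
    codiff (fun z => a ^ 3 • φ z) y = a • codiff φ y := by
  rw [codiff, codiff]
  simp only [hodgeStar_cube_smul ha]
  rw [extDeriv_const_smul, hodgeStar_cube_smul ha, smul_neg]
  -- The inner star gives `a ^ (7 - 6 + 3) = a ^ 4`, the outer one `a ^ (7 - 10)`.
  congr 2
  field_simp

/-- Both squared norms have weight `-2`: `-8 + 6` for the 4-form `dφ` and `-4 + 2` for the 2-form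
`δφ`. The volume adds 7. -/
theorem energyDensity_cube_smul {a : ℝ} (ha : 0 < a) (φ : R7 → R7 [⋀^Fin 3]→L[ℝ] ℝ) (y : R7) :
    energyDensity (fun z => a ^ 3 • φ z) y = a ^ 5 * energyDensity φ y := by
  rw [energyDensity, energyDensity, codiff_cube_smul ha, extDeriv_const_smul,
    formInner_cube_smul ha, formInner_cube_smul ha, volCoeff_cube_smul ha, abs_mul,
    abs_of_pos (pow_pos ha 7)]
  generalize formInner (φ y) (extDeriv φ y) (extDeriv φ y) = X
  norm_num
  field_simp

/-! ### Differentiation under the integral sign -/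

theorem hasDerivAt_setIntegral_of_isCompact {E : Type*} [NormedAddCommGroup E] [NormedSpace ℝ E]
    [MeasurableSpace E] [BorelSpace E] {μ : MeasureTheory.Measure E}
    [MeasureTheory.IsFiniteMeasureOnCompacts μ] {K : Set E} (hK : IsCompact K) {w : E → ℝ}
    (hw : ContinuousOn w K) {g : ℝ × E → ℝ} {s₀ : ℝ} (hg : ∀ y ∈ K, ContDiffAt ℝ 1 g (s₀, y)) :
    HasDerivAt (fun s => ∫ y in K, w y * g (s, y) ∂μ)
      (∫ y in K, w y * deriv (fun s => g (s, y)) s₀ ∂μ) s₀ := by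
  -- Being `C¹` at a point is an open condition, so the tube lemma gives an interval of parameters
  -- uniform over `K`; there the derivative is bounded by compactness.
  let W : Set (ℝ × E) := {p | ContDiffAt ℝ 1 g p}
  have hW : IsOpen W := isOpen_iff_mem_nhds.2 fun p hp =>
    ContDiffAt.eventually (show ContDiffAt ℝ 1 g p from hp) (by simp)
  obtain ⟨u, v, hu, -, hsu, hKv, huv⟩ := generalized_tube_lemma (s := {s₀}) isCompact_singleton hK
    hW (by rintro ⟨s, y⟩ ⟨rfl, hy⟩; exact hg y hy)
  obtain ⟨ε, hε, hεu⟩ := Metric.nhds_basis_closedBall.mem_iff.1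
    (hu.mem_nhds (hsu (Set.mem_singleton s₀)))
  have hcd : ∀ s ∈ Metric.closedBall s₀ ε, ∀ y ∈ K, ContDiffAt ℝ 1 g (s, y) :=
    fun s hs y hy => huv ⟨hεu hs, hKv hy⟩
  let g' : ℝ × E → ℝ := fun p => fderiv ℝ g p (1, 0)
  have hd : ∀ s ∈ Metric.closedBall s₀ ε, ∀ y ∈ K,
      HasDerivAt (fun r => g (r, y)) (g' (s, y)) s := by
    intro s hs y hy
    have h1 : HasFDerivAt g (fderiv ℝ g (s, y)) (s, y) :=
      ((hcd s hs y hy).differentiableAt (by norm_num)).hasFDerivAt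
    have h2 : HasDerivAt (fun r : ℝ => (r, y)) ((1 : ℝ), (0 : E)) s :=
      (hasDerivAt_id s).prodMk (hasDerivAt_const s y)
    exact h1.comp_hasDerivAt s h2
  have hg'c : ContinuousOn g' (Metric.closedBall s₀ ε ×ˢ K) := by
    rintro ⟨s, y⟩ ⟨hs, hy⟩
    have := (hcd s hs y hy).continuousAt_fderiv (by norm_num)
    exact (this.clm_apply continuousAt_const).continuousWithinAt
  have hs₀ : s₀ ∈ Metric.closedBall s₀ ε := Metric.mem_closedBall_self hε.le
  have hgc : ∀ s ∈ Metric.closedBall s₀ ε, ContinuousOn (fun y => w y * g (s, y)) K := by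
    intro s hs
    refine hw.mul fun y hy => ?_
    have h1 : ContinuousAt (fun z : E => (s, z)) y := by fun_prop
    have h2 : ContinuousAt g (s, y) := (hcd s hs y hy).continuousAt
    exact (ContinuousAt.comp (f := fun z : E => (s, z)) h2 h1).continuousWithinAt
  have hg'K : ContinuousOn (fun y => w y * g' (s₀, y)) K := by
    refine hw.mul (hg'c.comp (by fun_prop) fun y hy => ⟨hs₀, hy⟩)
  obtain ⟨C, hC⟩ := ((isCompact_closedBall s₀ ε).prod hK).exists_bound_of_continuousOn hg'c
  obtain ⟨D, hD⟩ := hK.exists_bound_of_continuousOn hw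
  have hmeas := hK.measurableSet
  have key := (hasDerivAt_integral_of_dominated_loc_of_deriv_le (μ := μ.restrict K)
    (F := fun s y => w y * g (s, y)) (F' := fun s y => w y * g' (s, y)) (x₀ := s₀)
    (s := Metric.closedBall s₀ ε) (bound := fun _ => D * C) (Metric.closedBall_mem_nhds s₀ hε)
    ?_ ?_ ?_ ?_ ?_ ?_).2
  · refine key.congr_deriv ?_
    refine MeasureTheory.setIntegral_congr_fun hmeas fun y hy => ?_
    simp only [(hd s₀ hs₀ y hy).deriv]
  · filter_upwards [Metric.closedBall_mem_nhds s₀ hε] with s hs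
    exact (hgc s hs).aestronglyMeasurable_of_isCompact hK hmeas
  · exact (hgc s₀ hs₀).integrableOn_compact hK
  · exact hg'K.aestronglyMeasurable_of_isCompact hK hmeas
  · refine (MeasureTheory.ae_restrict_iff' hmeas).2 (Filter.Eventually.of_forall fun y hy s hs => ?_)
    rw [norm_mul]
    exact mul_le_mul (hD y hy) (hC (s, y) ⟨hs, hy⟩) (norm_nonneg _)
      ((norm_nonneg _).trans (hD y hy))
  · exact (continuousOn_const (c := D * C)).integrableOn_compact hK
  · refine (MeasureTheory.ae_restrict_iff' hmeas).2 (Filter.Eventually.of_forall fun y hy s hs => ?_)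
    exact (hd s hs y hy).const_mul (w y)

/-! ### Integration of densities on the manifold -/

section ManifoldIntegral

variable {M : Type*} [TopologicalSpace M] [ChartedSpace R7 M]
  [IsManifold (𝓡 7) ∞ M] [T2Space M] [CompactSpace M]

theorem finite_support_chartPartition :
    {c : M | (Function.support (chartPartition M c)).Nonempty}.Finite :=
  (chartPartition M).locallyFinite.finite_nonempty_of_compact

/-- The image in the chart around `c` of the support of the corresponding cutoff function. -/
def chartSupport (c : M) : Set R7 := chartAt R7 c '' tsupport (chartPartition M c)

theorem isCompact_chartSupport (c : M) : IsCompact (chartSupport c) :=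
  (isClosed_tsupport _).isCompact.image_of_continuousOn
    ((chartAt R7 c).continuousOn.mono (chartPartition_isSubordinate c))

theorem chartSupport_subset (c : M) : chartSupport c ⊆ (chartAt R7 c).target := by
  rintro _ ⟨x, hx, rfl⟩
  exact (chartAt R7 c).map_source (chartPartition_isSubordinate c hx)

theorem continuousOn_chartPartition_symm (c : M) :
    ContinuousOn (fun y => chartPartition M c ((chartAt R7 c).symm y)) (chartAt R7 c).target :=
  (chartPartition M c).contMDiff.continuous.comp_continuousOn (chartAt R7 c).continuousOn_symm

/-- Replaces the open chart target by a compact set, on which one may differentiate under the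
integral. -/
theorem setIntegral_chart_eq (c : M) (f : R7 → ℝ) :
    ∫ y in (chartAt R7 c).target, chartPartition M c ((chartAt R7 c).symm y) * f y =
      ∫ y in chartSupport c, chartPartition M c ((chartAt R7 c).symm y) * f y := by
  refine MeasureTheory.setIntegral_eq_of_subset_of_forall_sdiff_eq_zero
    (chartAt R7 c).open_target.measurableSet (chartSupport_subset c) ?_
  rintro y ⟨hy, hyK⟩
  by_contra h
  refine hyK ⟨(chartAt R7 c).symm y, subset_tsupport _ (left_ne_zero_of_mul h), ?_⟩
  exact (chartAt R7 c).right_inv hy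

/-- The finite index set does not depend on `f`, so the sum commutes with differentiation. -/
theorem integral_eq_sum (f : M → R7 → ℝ) :
    integral f = ∑ c ∈ (finite_support_chartPartition (M := M)).toFinset,
      ∫ y in (chartAt R7 c).target, chartPartition M c ((chartAt R7 c).symm y) * f c y := by
  refine finsum_eq_sum_of_support_subset _ fun c hc => ?_
  rw [Set.Finite.coe_toFinset]
  by_contra h
  refine hc ?_
  have h0 : ∀ x, chartPartition M c x = 0 := by
    intro x
    by_contra hx
    exact h ⟨x, hx⟩
  simp [h0]

theorem integral_congr {f f' : M → R7 → ℝ}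
    (h : ∀ c, ∀ y ∈ (chartAt R7 c).target, f c y = f' c y) : integral f = integral f' := by
  refine finsum_congr fun c => MeasureTheory.setIntegral_congr_fun
    (chartAt R7 c).open_target.measurableSet fun y hy => ?_
  simp only [h c y hy]

theorem integral_const_mul (a : ℝ) (f : M → R7 → ℝ) :
    integral (fun c y => a * f c y) = a * integral f := by
  rw [integral_eq_sum, integral_eq_sum, Finset.mul_sum]
  refine Finset.sum_congr rfl fun c _ => ?_
  rw [← MeasureTheory.integral_const_mul]
  simp only [mul_left_comm]

theorem integral_nonneg {f : M → R7 → ℝ} (h : ∀ c, ∀ y ∈ (chartAt R7 c).target, 0 ≤ f c y) :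
    0 ≤ integral f :=
  finsum_nonneg fun c => MeasureTheory.setIntegral_nonneg
    (chartAt R7 c).open_target.measurableSet fun y hy =>
      mul_nonneg ((chartPartition M).nonneg c _) (h c y hy)

theorem hasDerivAt_integral {f : ℝ → M → R7 → ℝ} {s₀ : ℝ}
    (hf : ∀ c, ∀ y ∈ (chartAt R7 c).target,
      ContDiffAt ℝ 1 (fun p : ℝ × R7 => f p.1 c p.2) (s₀, y)) :
    HasDerivAt (fun s => integral (f s)) (integral fun c y => deriv (fun s => f s c y) s₀) s₀ := by
  simp only [integral_eq_sum, setIntegral_chart_eq]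
  refine HasDerivAt.fun_sum fun c _ => ?_
  exact hasDerivAt_setIntegral_of_isCompact (g := fun p : ℝ × R7 => f p.1 c p.2)
    (isCompact_chartSupport c)
    ((continuousOn_chartPartition_symm c).mono (chartSupport_subset c))
    fun y hy => hf c y (chartSupport_subset c hy)

end ManifoldIntegral

/-! ### Jets of families of forms -/

section Jets

variable {X V : Type*} [NormedAddCommGroup X] [NormedSpace ℝ X] [NormedAddCommGroup V]
  [NormedSpace ℝ V] {F : ℝ × X → V} {s₀ : ℝ} {y : X}

theorem two_le_infty : (2 : WithTop ℕ∞) ≤ ∞ := by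
  exact WithTop.coe_le_coe.2 (le_top : (2 : ℕ∞) ≤ ⊤)

theorem one_le_infty : (1 : WithTop ℕ∞) ≤ ∞ := by
  exact_mod_cast (le_top : (1 : ℕ∞) ≤ ⊤)

/-- The spatial 1-jet of a one-parameter family of maps. -/
def familyJet (F : ℝ × X → V) (p : ℝ × X) : V × (X →L[ℝ] V) :=
  (F p, (fderiv ℝ F p).comp (ContinuousLinearMap.inr ℝ ℝ X))

/-- The derivative of a function of 1-jets. -/
def jetDeriv (e : V × (X →L[ℝ] V) → ℝ) (p q : V × (X →L[ℝ] V)) : ℝ := fderiv ℝ e p q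

theorem hasFDerivAt_slice {p : ℝ × X} (hF : DifferentiableAt ℝ F p) :
    HasFDerivAt (fun z => F (p.1, z)) ((fderiv ℝ F p).comp (ContinuousLinearMap.inr ℝ ℝ X)) p.2 := by
  have h1 : HasFDerivAt (fun z : X => (p.1, z)) (ContinuousLinearMap.inr ℝ ℝ X) p.2 :=
    hasFDerivAt_prodMk_right p.1 p.2
  exact HasFDerivAt.comp (f := fun z : X => (p.1, z)) p.2 hF.hasFDerivAt h1

theorem contDiffAt_familyJet (hF : ContDiffAt ℝ ∞ F (s₀, y)) :
    ContDiffAt ℝ 1 (familyJet F) (s₀, y) := by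
  have h1 : ContDiffAt ℝ 1 F (s₀, y) := hF.of_le one_le_infty
  have h2 : ContDiffAt ℝ 1 (fderiv ℝ F) (s₀, y) :=
    hF.fderiv_right (m := 1) (by norm_num; exact two_le_infty)
  exact h1.prodMk (h2.clm_comp contDiffAt_const)

/-- The time derivative of the spatial jet is the jet of the time derivative. -/
theorem hasDerivAt_familyJet (hF : ContDiffAt ℝ ∞ F (s₀, y)) {ψ : X → V}
    (hψ : ∀ᶠ z in 𝓝 y, HasDerivAt (fun s => F (s, z)) (ψ z) s₀) :
    HasDerivAt (fun s => familyJet F (s, y)) (ψ y, fderiv ℝ ψ y) s₀ := by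
  have h2 : ContDiffAt ℝ 2 F (s₀, y) := hF.of_le two_le_infty
  have hd2 : DifferentiableAt ℝ (fderiv ℝ F) (s₀, y) :=
    (h2.fderiv_right (m := 1) (by norm_num)).differentiableAt (by norm_num)
  have hline : ∀ z : X, HasDerivAt (fun s : ℝ => (s, z)) ((1 : ℝ), (0 : X)) s₀ :=
    fun z => (hasDerivAt_id s₀).prodMk (hasDerivAt_const s₀ z)
  -- Equality of mixed partials is what exchanges the time and space derivatives.
  have hsymm : IsSymmSndFDerivAt ℝ F (s₀, y) := h2.isSymmSndFDerivAt (by simp)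
  have hslice : Filter.Tendsto (fun z : X => (s₀, z)) (𝓝 y) (𝓝 (s₀, y)) :=
    Continuous.tendsto' (by fun_prop) _ _ rfl
  have hψ' : ψ =ᶠ[𝓝 y] fun z => fderiv ℝ F (s₀, z) (1, 0) := by
    filter_upwards [hψ, hslice.eventually (h2.eventually (by simp))] with z hz hz2
    have h := (hz2.differentiableAt (by norm_num)).hasFDerivAt.comp_hasDerivAt s₀ (hline z)
    exact hz.unique h
  have hD : HasFDerivAt (fun z => fderiv ℝ F (s₀, z) (1, 0))
      (((fderiv ℝ (fderiv ℝ F) (s₀, y)).comp (ContinuousLinearMap.inr ℝ ℝ X)).flip (1, 0)) y := by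
    have h1 : HasFDerivAt (fun z : X => (s₀, z)) (ContinuousLinearMap.inr ℝ ℝ X) y :=
      hasFDerivAt_prodMk_right s₀ y
    have h3 := HasFDerivAt.comp (f := fun z : X => (s₀, z)) y hd2.hasFDerivAt h1
    have h4 := h3.clm_apply (hasFDerivAt_const ((1 : ℝ), (0 : X)) y)
    refine h4.congr_fderiv ?_
    ext v
    simp
  have hfψ : fderiv ℝ ψ y =
      (fderiv ℝ (fderiv ℝ F) (s₀, y) (1, 0)).comp (ContinuousLinearMap.inr ℝ ℝ X) := by
    rw [hψ'.fderiv_eq, hD.fderiv]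
    ext v : 1
    exact hsymm (0, v) (1, 0)
  have hA : HasDerivAt (fun s => fderiv ℝ F (s, y)) (fderiv ℝ (fderiv ℝ F) (s₀, y) (1, 0)) s₀ :=
    hd2.hasFDerivAt.comp_hasDerivAt s₀ (hline y)
  have hB : HasDerivAt (fun s => (fderiv ℝ F (s, y)).comp (ContinuousLinearMap.inr ℝ ℝ X))
      ((fderiv ℝ (fderiv ℝ F) (s₀, y) (1, 0)).comp (ContinuousLinearMap.inr ℝ ℝ X)) s₀ := by
    have := hA.clm_comp (hasDerivAt_const s₀ (ContinuousLinearMap.inr ℝ ℝ X))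
    simpa using this
  rw [hfψ]
  exact hψ.self_of_nhds.prodMk hB

theorem contDiffAt_jet_comp {e : V × (X →L[ℝ] V) → ℝ} (hF : ContDiffAt ℝ ∞ F (s₀, y))
    (he : ContDiffAt ℝ ∞ e (familyJet F (s₀, y))) :
    ContDiffAt ℝ 1 (fun p => e (familyJet F p)) (s₀, y) :=
  (he.of_le one_le_infty).comp (s₀, y) (contDiffAt_familyJet hF)

theorem hasDerivAt_jet_comp {e : V × (X →L[ℝ] V) → ℝ} (hF : ContDiffAt ℝ ∞ F (s₀, y))
    (he : ContDiffAt ℝ ∞ e (familyJet F (s₀, y))) {ψ : X → V}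
    (hψ : ∀ᶠ z in 𝓝 y, HasDerivAt (fun s => F (s, z)) (ψ z) s₀) :
    HasDerivAt (fun s => e (familyJet F (s, y)))
      (jetDeriv e (F (s₀, y), fderiv ℝ (fun z => F (s₀, z)) y) (ψ y, fderiv ℝ ψ y)) s₀ := by
  have h4 := (hasFDerivAt_slice (hF.differentiableAt (by simp))).fderiv
  rw [h4]
  exact (he.differentiableAt (by simp)).hasFDerivAt.comp_hasDerivAt s₀ (hasDerivAt_familyJet hF hψ)

end Jets

section EnergyDensity

variable {F : ℝ × R7 → R7 [⋀^Fin 3]→L[ℝ] ℝ} {s₀ : ℝ} {y : R7}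

theorem eventually_energyDensity_eq (hF : ContDiffAt ℝ ∞ F (s₀, y))
    (h : (hitchinMatrix (F (s₀, y))).det ≠ 0) :
    (fun p : ℝ × R7 => energyDensity (fun z => F (p.1, z)) p.2) =ᶠ[𝓝 (s₀, y)]
      fun p => jetEnergy (familyJet F p) := by
  have h1 : ContDiffAt ℝ 1 F (s₀, y) := hF.of_le one_le_infty
  have hc : ContinuousAt (fun p => (hitchinMatrix (F p)).det) (s₀, y) :=
    (contDiff_det_hitchinMatrix (n := 0)).continuous.continuousAt.comp hF.continuousAt
  filter_upwards [h1.eventually (by simp), hc.eventually_ne h] with p hp hp0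
  have h3 := hasFDerivAt_slice (hp.differentiableAt (by norm_num))
  rw [energyDensity_eq_jetEnergy h3.differentiableAt hp0, h3.fderiv]
  rfl

theorem contDiffAt_energyDensity (hF : ContDiffAt ℝ ∞ F (s₀, y))
    (h : (hitchinMatrix (F (s₀, y))).det ≠ 0) :
    ContDiffAt ℝ 1 (fun p : ℝ × R7 => energyDensity (fun z => F (p.1, z)) p.2) (s₀, y) := by
  refine ContDiffAt.congr_of_eventuallyEq ?_ (eventually_energyDensity_eq hF h)
  exact contDiffAt_jet_comp hF (contDiffAt_jetEnergy (p := familyJet F (s₀, y)) h)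

theorem deriv_energyDensity (hF : ContDiffAt ℝ ∞ F (s₀, y))
    (h : (hitchinMatrix (F (s₀, y))).det ≠ 0) {ψ : R7 → R7 [⋀^Fin 3]→L[ℝ] ℝ}
    (hψ : ∀ᶠ z in 𝓝 y, HasDerivAt (fun s => F (s, z)) (ψ z) s₀) :
    deriv (fun s => energyDensity (fun z => F (s, z)) y) s₀ =
      jetDeriv jetEnergy (F (s₀, y), fderiv ℝ (fun z => F (s₀, z)) y) (ψ y, fderiv ℝ ψ y) := by
  have h2 := hasDerivAt_jet_comp hF (contDiffAt_jetEnergy (p := familyJet F (s₀, y)) h) hψ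
  have hline : Filter.Tendsto (fun s : ℝ => (s, y)) (𝓝 s₀) (𝓝 (s₀, y)) :=
    Continuous.tendsto' (by fun_prop) _ _ rfl
  exact (h2.congr_of_eventuallyEq (hline.eventually (eventually_energyDensity_eq hF h))).deriv

end EnergyDensity

/-! ### Variation of the energy and of the volume -/

variable {M : Type*} [TopologicalSpace M] [ChartedSpace R7 M]

theorem inChart_add_smul (φ ψ : ThreeForm M) (s : ℝ) (c : M) (y : R7) :
    inChart (φ + s • ψ) c y = inChart φ c y + s • inChart ψ c y := rfl

/-- A family of 3-forms is smooth at time `s₀`, is positive there, and has time derivative `ψ`. -/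
structure HasVariation (Φ : ℝ → ThreeForm M) (ψ : ThreeForm M) (s₀ : ℝ) : Prop where
  positive : IsPositive (Φ s₀)
  smooth : ∀ c, ∀ y ∈ (chartAt R7 c).target,
    ContDiffAt ℝ ∞ (fun p : ℝ × R7 => inChart (Φ p.1) c p.2) (s₀, y)
  deriv : ∀ c, ∀ y ∈ (chartAt R7 c).target,
    HasDerivAt (fun s => inChart (Φ s) c y) (inChart ψ c y) s₀

/-- Positivity is asked only at parameter zero: differentiation needs a nonzero Hitchin determinant,
an open condition. -/
theorem hasVariation_line {φ ψ : ThreeForm M} (hpos : IsPositive φ) (hφ : IsSmooth φ)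
    (hψ : IsSmooth ψ) : HasVariation (fun s => φ + s • ψ) ψ 0 := by
  refine ⟨by simpa using hpos, fun c y hy => ?_, fun c y hy => ?_⟩
  · simp only [inChart_add_smul]
    have hn := (chartAt R7 c).open_target.mem_nhds hy
    have h1 : ContDiffAt ℝ ∞ (fun p : ℝ × R7 => inChart φ c p.2) ((0 : ℝ), y) :=
      ContDiffAt.comp (f := fun p : ℝ × R7 => p.2) (g := inChart φ c) ((0 : ℝ), y)
        ((hφ c).contDiffAt hn) contDiffAt_snd
    have h2 : ContDiffAt ℝ ∞ (fun p : ℝ × R7 => inChart ψ c p.2) ((0 : ℝ), y) :=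
      ContDiffAt.comp (f := fun p : ℝ × R7 => p.2) (g := inChart ψ c) ((0 : ℝ), y)
        ((hψ c).contDiffAt hn) contDiffAt_snd
    exact h1.add (contDiffAt_fst.smul h2)
  · simp only [inChart_add_smul]
    have := ((hasDerivAt_id (0 : ℝ)).smul_const (inChart ψ c y)).const_add (inChart φ c y)
    simpa using this

variable [IsManifold (𝓡 7) ∞ M]

theorem IsPositive.isPos_inChart {φ : ThreeForm M} (h : IsPositive φ) (c : M) {y : R7}
    (hy : y ∈ (chartAt R7 c).target) : IsPos (inChart φ c y) := by
  have : IsManifold (𝓡 7) 1 M := IsManifold.of_le (n := ∞) one_le_infty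
  obtain ⟨A, hA⟩ := h ((chartAt R7 c).symm y)
  have hd : (chartAt R7 c).symm.MDifferentiable (𝓡 7) (𝓡 7) :=
    (mdifferentiable_chart (I := 𝓡 7) c).symm
  let B : R7 ≃L[ℝ] TangentSpace (𝓡 7) ((chartAt R7 c).symm y) := hd.mfderiv hy
  refine ⟨B.trans A, ?_⟩
  rw [inChart, hA]
  rfl

variable [T2Space M] [CompactSpace M]

/-- The volume of `M` for the metric induced by a 3-form. -/
def volume (φ : ThreeForm M) : ℝ := integral fun c y => absVol (inChart φ c y)

/-- The first variation of the Dirichlet energy. -/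
def energyVariation (φ ψ : ThreeForm M) : ℝ := integral fun c y =>
  jetDeriv jetEnergy (inChart φ c y, fderiv ℝ (inChart φ c) y)
    (inChart ψ c y, fderiv ℝ (inChart ψ c) y)

/-- The first variation of the volume. -/
def volumeVariation (φ ψ : ThreeForm M) : ℝ := integral fun c y =>
  fderiv ℝ absVol (inChart φ c y) (inChart ψ c y)

theorem HasVariation.hasDerivAt_dirichletEnergy {Φ : ℝ → ThreeForm M} {ψ : ThreeForm M} {s₀ : ℝ}
    (h : HasVariation Φ ψ s₀) :
    HasDerivAt (fun s => dirichletEnergy (Φ s)) (energyVariation (Φ s₀) ψ) s₀ := by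
  have hdet : ∀ c, ∀ y ∈ (chartAt R7 c).target, (hitchinMatrix (inChart (Φ s₀) c y)).det ≠ 0 :=
    fun c y hy => (h.positive.isPos_inChart c hy).det_ne_zero
  refine (hasDerivAt_integral (f := fun s c y => energyDensity (inChart (Φ s) c) y) fun c y hy =>
    contDiffAt_energyDensity (F := fun p : ℝ × R7 => inChart (Φ p.1) c p.2) (h.smooth c y hy)
      (hdet c y hy)).congr_deriv (integral_congr fun c y hy => ?_)
  refine deriv_energyDensity (ψ := inChart ψ c) (F := fun p : ℝ × R7 => inChart (Φ p.1) c p.2) (h.smooth c y hy)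
    (hdet c y hy) ?_
  filter_upwards [(chartAt R7 c).open_target.mem_nhds hy] with z hz
  exact h.deriv c z hz

theorem HasVariation.hasDerivAt_volume {Φ : ℝ → ThreeForm M} {ψ : ThreeForm M} {s₀ : ℝ}
    (h : HasVariation Φ ψ s₀) :
    HasDerivAt (fun s => volume (Φ s)) (volumeVariation (Φ s₀) ψ) s₀ := by
  have hdet : ∀ c, ∀ y ∈ (chartAt R7 c).target, (hitchinMatrix (inChart (Φ s₀) c y)).det ≠ 0 :=
    fun c y hy => (h.positive.isPos_inChart c hy).det_ne_zero
  refine (hasDerivAt_integral (f := fun s c y => absVol (inChart (Φ s) c y)) fun c y hy =>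
    ?_).congr_deriv (integral_congr fun c y hy => ?_)
  · have h1 : ContDiffAt ℝ 1 (fun p : ℝ × R7 => inChart (Φ p.1) c p.2) (s₀, y) :=
      (h.smooth c y hy).of_le one_le_infty
    exact ContDiffAt.comp (f := fun p : ℝ × R7 => inChart (Φ p.1) c p.2) (g := absVol) (s₀, y)
      (contDiffAt_absVol (n := 1) (hdet c y hy)) h1
  · exact ((differentiableAt_absVol (hdet c y hy)).hasFDerivAt.comp_hasDerivAt s₀
      (h.deriv c y hy)).deriv

/-- Uniqueness of the derivative along a line; the resulting formula then applies to any family with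
velocity `ψ`. -/
theorem IsNegGradient.energyVariation_eq {φ Q ψ : ThreeForm M} (hQ : IsNegGradient φ Q)
    (hpos : IsPositive φ) (hφ : IsSmooth φ) (hψ : IsSmooth ψ) :
    energyVariation φ ψ = -l2Inner φ Q ψ := by
  have h := (hasVariation_line hpos hφ hψ).hasDerivAt_dirichletEnergy
  simp only [zero_smul, add_zero] at h
  exact h.unique (hQ.2 ψ hψ)

theorem dirichletEnergy_cube_smul {a : ℝ} (ha : 0 < a) (φ : ThreeForm M) :
    dirichletEnergy (a ^ 3 • φ) = a ^ 5 * dirichletEnergy φ := by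
  rw [dirichletEnergy, dirichletEnergy, ← integral_const_mul]
  refine integral_congr fun c y _ => ?_
  exact energyDensity_cube_smul ha (inChart φ c) y

/-- Euler's identity for the Dirichlet energy. -/
theorem energyVariation_self {φ : ThreeForm M} (hpos : IsPositive φ) (hφ : IsSmooth φ) :
    energyVariation φ φ = 5 / 3 * dirichletEnergy φ := by
  have h := (hasVariation_line hpos hφ hφ).hasDerivAt_dirichletEnergy
  simp only [zero_smul, add_zero] at h
  have h1 : HasDerivAt (fun s : ℝ => (1 + s) ^ (5 / 3 : ℝ) * dirichletEnergy φ)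
      (5 / 3 * dirichletEnergy φ) 0 := by
    have h2 : HasDerivAt (fun s : ℝ => 1 + s) 1 0 := (hasDerivAt_id (0 : ℝ)).const_add 1
    have h3 := (h2.rpow_const (p := 5 / 3) (Or.inl (by norm_num))).mul_const (dirichletEnergy φ)
    simpa using h3
  refine h.unique (h1.congr_of_eventuallyEq ?_)
  filter_upwards [lt_mem_nhds (show (-1 : ℝ) < 0 by norm_num)] with s hs
  have hs' : 0 < 1 + s := by linarith
  -- The cubic scaling law is applied with `a = (1 + s)^(1/3)`.
  have e3 : ((1 + s) ^ (1 / 3 : ℝ)) ^ 3 = 1 + s := by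
    rw [← Real.rpow_natCast, ← Real.rpow_mul hs'.le]; norm_num
  have e5 : ((1 + s) ^ (1 / 3 : ℝ)) ^ 5 = (1 + s) ^ (5 / 3 : ℝ) := by
    rw [← Real.rpow_natCast, ← Real.rpow_mul hs'.le]; norm_num
  have := dirichletEnergy_cube_smul (Real.rpow_pos_of_pos hs' (1 / 3)) φ
  rw [e3, e5] at this
  rw [← this, add_smul, one_smul]

theorem dirichletEnergy_nonneg {φ : ThreeForm M} (hpos : IsPositive φ) : 0 ≤ dirichletEnergy φ :=
  integral_nonneg fun c _ hy => energyDensity_nonneg (hpos.isPos_inChart c hy)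

theorem l2Inner_self_nonneg {φ : ThreeForm M} (hpos : IsPositive φ) (α : ThreeForm M) :
    0 ≤ l2Inner φ α α :=
  integral_nonneg fun c _ hy =>
    mul_nonneg ((hpos.isPos_inChart c hy).formInner_self_nonneg _) (abs_nonneg _)

theorem l2Inner_comm {φ : ThreeForm M} (hpos : IsPositive φ) (α β : ThreeForm M) :
    l2Inner φ α β = l2Inner φ β α :=
  integral_congr fun c _ hy => by rw [(hpos.isPos_inChart c hy).formInner_comm]

theorem volume_nonneg (φ : ThreeForm M) : 0 ≤ volume φ :=
  integral_nonneg fun _ _ _ => abs_nonneg _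

theorem exists_volumeVariation_eq : ∃ κ : ℝ, 0 < κ ∧ ∀ φ ψ : ThreeForm M, IsPositive φ →
    volumeVariation φ ψ = κ * l2Inner φ φ ψ := by
  obtain ⟨κ, hκ, h⟩ := exists_fderiv_absVol
  refine ⟨κ, hκ, fun φ ψ hpos => ?_⟩
  rw [l2Inner, ← integral_const_mul]
  exact integral_congr fun c y hy => h _ (hpos.isPos_inChart c hy) _

/-! ### The flow -/

theorem IsDirichletFlow.isSmooth {Ω : ℝ → ThreeForm M} (hΩ : IsDirichletFlow Ω) {t : ℝ}
    (ht : 0 ≤ t) : IsSmooth (Ω t) := fun c =>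
  (hΩ.smooth c).comp (f := fun y : R7 => (t, y)) (contDiff_const.prodMk contDiff_id).contDiffOn
    fun _ hy => ⟨ht, hy⟩

/-- At `t > 0` the half-line is a neighbourhood, so one-sided smoothness and derivatives become
two-sided. -/
theorem IsDirichletFlow.exists_hasVariation {Ω : ℝ → ThreeForm M} (hΩ : IsDirichletFlow Ω) {t : ℝ}
    (ht : 0 < t) : ∃ Q : ThreeForm M, IsNegGradient (Ω t) Q ∧ HasVariation Ω Q t := by
  obtain ⟨Q, hQ, hd⟩ := hΩ.flow t ht.le
  have hsm : ∀ c, ∀ y ∈ (chartAt R7 c).target,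
      ContDiffAt ℝ ∞ (fun p : ℝ × R7 => inChart (Ω p.1) c p.2) (t, y) := fun c y hy =>
    (hΩ.smooth c).contDiffAt
      (prod_mem_nhds (Ici_mem_nhds ht) ((chartAt R7 c).open_target.mem_nhds hy))
  refine ⟨Q, hQ, hΩ.positive t ht.le, hsm, fun c y hy => ?_⟩
  have h1 : HasDerivAt (fun s : ℝ => (s, y)) ((1 : ℝ), (0 : R7)) t :=
    (hasDerivAt_id t).prodMk (hasDerivAt_const t y)
  have h2 := ((hsm c y hy).differentiableAt (by simp)).hasFDerivAt.comp_hasDerivAt t h1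
  refine h2.congr_deriv ?_
  -- The flow equation holds after evaluation on vectors, so the two derivatives are compared
  -- component by component.
  refine comp_ext fun I => ?_
  have h3 := (compL I).hasFDerivAt.comp_hasDerivAt t h2
  have h4 := (hd ((chartAt R7 c).symm y) fun a =>
    mfderiv (𝓡 7) (𝓡 7) (chartAt R7 c).symm y (stdVec (I a))).hasDerivAt (Ici_mem_nhds ht)
  exact h3.unique h4

/-- A nonnegative antitone function which is, up to a constant, minus the derivative of a
nonnegative function tends to zero. -/
theorem tendsto_zero_of_antitone_of_deriv {D V : ℝ → ℝ} {κ : ℝ} (hκ : 0 < κ)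
    (hD : ∀ t, 0 < t → 0 ≤ D t) (hV : ∀ t, 0 < t → 0 ≤ V t) (hanti : AntitoneOn D (Set.Ioi 0))
    (hderiv : ∀ t, 0 < t → HasDerivAt V (-(κ * D t)) t) :
    Filter.Tendsto D Filter.atTop (𝓝 0) := by
  rw [Metric.tendsto_atTop]
  intro ε hε
  by_contra hcon
  push Not at hcon
  -- Values of at least `ε` at arbitrarily late times propagate to all earlier times by
  -- monotonicity.
  have hlow : ∀ t, 0 < t → ε ≤ D t := by
    intro t ht
    obtain ⟨r, hr, hr'⟩ := hcon t
    have hr0 : 0 < r := ht.trans_le hr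
    rw [Real.dist_eq, sub_zero, abs_of_nonneg (hD r hr0)] at hr'
    exact hr'.trans (hanti ht hr0 hr)
  -- Falling at rate at least `κ * ε`, `V` loses at least `V 1 + 1` on `[1, T]`, hence becomes
  -- negative.
  let T : ℝ := 1 + (V 1 + 1) / (κ * ε)
  have hT : 1 < T := by
    have := hV 1 one_pos
    have : 0 < (V 1 + 1) / (κ * ε) := by positivity
    simp only [T]; linarith
  obtain ⟨ξ, hξ, hslope⟩ := exists_hasDerivAt_eq_slope V (fun t => -(κ * D t)) hT
    (fun t ht => (hderiv t (one_pos.trans_le ht.1)).continuousAt.continuousWithinAt)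
    (fun t ht => hderiv t (one_pos.trans ht.1))
  have hξ' := hlow ξ (one_pos.trans hξ.1)
  have hT1 : 0 < T - 1 := sub_pos.2 hT
  rw [eq_div_iff hT1.ne'] at hslope
  have hVT := hV T (one_pos.trans hT)
  have h1 : κ * ε * (T - 1) ≤ κ * D ξ * (T - 1) := by gcongr
  have h2 : κ * ε * (T - 1) = V 1 + 1 := by
    simp only [T]; field_simp; ring
  linarith

theorem IsDirichletFlow.tendsto_dirichletEnergy {Ω : ℝ → ThreeForm M} (hΩ : IsDirichletFlow Ω) :
    Filter.Tendsto (fun t => dirichletEnergy (Ω t)) Filter.atTop (𝓝 0) := by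
  obtain ⟨κ, hκ, hvol⟩ := exists_volumeVariation_eq (M := M)
  have hE : ∀ t, 0 < t → ∃ d, d ≤ 0 ∧ HasDerivAt (fun t => dirichletEnergy (Ω t)) d t := by
    intro t ht
    obtain ⟨Q, hQ, hvar⟩ := hΩ.exists_hasVariation ht
    refine ⟨_, ?_, hvar.hasDerivAt_dirichletEnergy⟩
    -- With `ψ = Q` the derivative of the energy is `-‖Q‖²`.
    rw [hQ.energyVariation_eq hvar.positive (hΩ.isSmooth ht.le) hQ.1]
    exact neg_nonpos.2 (l2Inner_self_nonneg hvar.positive Q)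
  refine tendsto_zero_of_antitone_of_deriv (V := fun t => volume (Ω t)) (κ := κ * (5 / 3))
    (by positivity) (fun t ht => dirichletEnergy_nonneg (hΩ.positive t ht.le))
    (fun t _ => volume_nonneg _) ?_ ?_
  · refine antitoneOn_of_deriv_nonpos (convex_Ioi 0) ?_ ?_ ?_
    · intro t ht
      obtain ⟨d, -, hd⟩ := hE t ht
      exact hd.continuousAt.continuousWithinAt
    · intro t ht
      rw [interior_Ioi] at ht
      obtain ⟨d, -, hd⟩ := hE t ht
      exact hd.differentiableAt.differentiableWithinAt
    · intro t ht
      rw [interior_Ioi] at ht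
      obtain ⟨d, hd0, hd⟩ := hE t ht
      rw [hd.deriv]
      exact hd0
  · intro t ht
    obtain ⟨Q, hQ, hvar⟩ := hΩ.exists_hasVariation ht
    refine hvar.hasDerivAt_volume.congr_deriv ?_
    have h1 := energyVariation_self hvar.positive (hΩ.isSmooth ht.le)
    -- With `ψ = Ω t`, Euler's identity becomes `-⟨Q, Ω⟩ = 5/3 𝒟`, which is the volume derivative up
    -- to the factor `-κ`.
    rw [hQ.energyVariation_eq hvar.positive (hΩ.isSmooth ht.le) (hΩ.isSmooth ht.le)] at h1
    rw [hvol _ _ hvar.positive, l2Inner_comm hvar.positive]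
    linear_combination -κ * h1

end G2Flow

end

theorem corollary2p4 {M : Type*} [TopologicalSpace M] [ChartedSpace G2Flow.R7 M]
    [IsManifold (𝓡 7) ∞ M] [T2Space M] [CompactSpace M]
    (Ω : ℝ → G2Flow.ThreeForm M) (hΩ : G2Flow.IsDirichletFlow Ω) :
    Filter.Tendsto (fun t => G2Flow.dirichletEnergy (Ω t)) Filter.atTop (𝓝 0) :=
  hΩ.tendsto_dirichletEnergy
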